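/- Let $K$ be a number field with ring of integers $\mathcal{O}_K$ and class group $\mathrm{Cl}(K)$. Put $\widehat K=K\otimes_{\mathbb Q}\mathbb R$ and $\mathcal G=\mathrm{GL}(2,\widehat K)$, acting from the right on row vectors in $\widehat K^2$. A \emph{lattice} is a finitely generated $\mathcal{O}_K$-submodule $L\subset\widehat K^2$ such that $\widehat K L=\widehat K^2$, $\dim_K(KL)=2$, and $F_1\subseteq L\subseteq F_2$ for some free $\mathcal{O}_K$-submodules $F_1,F_2$ of $\widehat K^2$ of rank $2$. Its (Steinitz) class is the class $[\mathfrak a]\in \mathrm{Cl}(K)$ of an ideal $\mathfrak a$ such that $L\cong\mathcal{O}_K\oplus\mathfrak a$ as $\mathcal{O}_K$-modules. Let $\mathfrak n$ be a nonzero integral ideal. A \emph{modular point for $\Gamma_0(\mathfrak n)$} is a pair $P=(L,L')$ of lattices with $L\subseteq L'$ and $L'/L\cong\mathcal{O}_K/\mathfrak n$ as $\mathcal{O}_K$-modules; its class is that of $L$. The set of modular points of class $c$ is denoted $\mathcal M_0^{(c)}(\mathfrak n)$. For $U\in\mathcal G$ put $(L,L')U=(LU,L'U)$. Let $(\mathfrak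 p_i)_i$ be nonzero integral ideals whose classes represent each coset in $\mathrm{Cl}(K)/\mathrm{Cl}(K)^2$ exactly once, let $(\mathfrak q_j)_j$ be nonzero integral ideals such that the classes $[\mathfrak q_j]^2$ run through $\mathrm{Cl}(K)^2$, each taken exactly once, and put $c_{ij}=[\mathfrak p_i][\mathfrak q_j]^2$. The standard modular points are \[P_{ij}=(\mathfrak p_i\mathfrak q_j\oplus\mathfrak q_j,\ \mathfrak p_i\mathfrak q_j\oplus\mathfrak q_j\mathfrak n^{-1}),\] and an \emph{admissible basis matrix} for $P\in\mathcal M_0^{(c_{ij})}(\mathfrak n)$ is a matrix $U\in\mathcal G$ with $P=P_{ij}U$. For a nonzero integral ideal $\mathfrak p$ let $\Gamma_0^{\mathfrak p}(\mathfrak n)$ be the group of matrices $\begin{pmatrix}a&b\\c&d\end{pmatrix}$ over $K$ with $a,d\in\mathcal{O}_K$, $b\in\mathfrak p^{-1}$, $c\in\mathfrak n\mathfrak p$ and $ad-bc\in\mathcal{O}_K^\times$, viewed in $\mathcal G$ through $K\hookrightarrow\widehat K$. Then: (1) Every modular point for $\Gamma_0(\mathfrak n)$ has class $c_{ij}$ for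 exactly one pair $(i,j)$, and every modular point of class $c_{ij}$ has an admissible basis matrix. (2) If $U$ is an admissible basis matrix for $P\in\mathcal M_0^{(c_{ij})}(\mathfrak n)$, then the set of all admissible basis matrices for $P$ is the coset $\Gamma_0^{\mathfrak p_i}(\mathfrak n)U$. (3) For all $i,j$, $\mathcal M_0^{(c_{ij})}(\mathfrak n)=\{P_{ij}U\mid U\in\mathcal G\}$, and $P_{ij}U\leftrightarrow U$ is a well-defined bijection \[\mathcal M_0^{(c_{ij})}(\mathfrak n)\longleftrightarrow\Gamma_0^{\mathfrak p_i}(\mathfrak n)\backslash\mathcal G.\] -/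

import Mathlib

open scoped NumberField nonZeroDivisors TensorProduct

noncomputable section

namespace ModPt

section Basic

variable (K : Type*) [Field K] [NumberField K]

/-- `K̂ = K ⊗_ℚ ℝ`, the product of the archimedean completions of `K`. -/
abbrev Khat : Type _ := K ⊗[ℚ] ℝ

/-- The group `𝒢 = GL(2, K̂)`. -/
abbrev G : Type _ := Matrix.GeneralLinearGroup (Fin 2) (Khat K)

/-- The space `K̂²` of row vectors. -/
abbrev Row : Type _ := Fin 2 → Khat K

/-- Nonzero integral ideals of the ring of integers. -/
abbrev NzIdeal : Type _ := (Ideal (𝓞 K))⁰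

variable {K}

/-- A nonzero integral ideal, seen as a fractional ideal. -/
def NzIdeal.frac (𝔞 : NzIdeal K) : FractionalIdeal (𝓞 K)⁰ K :=
  ((𝔞 : Ideal (𝓞 K)) : FractionalIdeal (𝓞 K)⁰ K)

theorem NzIdeal.frac_ne_zero (𝔞 : NzIdeal K) : 𝔞.frac ≠ 0 := by
  rw [NzIdeal.frac, FractionalIdeal.coeIdeal_ne_zero]
  exact nonZeroDivisors.ne_zero 𝔞.2

/-- `𝓞_K`-lattices in `K̂²`. -/
structure IsLattice (L : Submodule (𝓞 K) (Row K)) : Prop where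
  span_eq_top : Submodule.span (Khat K) (L : Set (Row K)) = ⊤
  free_bounds : ∃ F₁ F₂ : Submodule (𝓞 K) (Row K),
    (Module.Free (𝓞 K) F₁ ∧ Module.finrank (𝓞 K) F₁ = 2) ∧
    (Module.Free (𝓞 K) F₂ ∧ Module.finrank (𝓞 K) F₂ = 2) ∧ F₁ ≤ L ∧ L ≤ F₂
  fg : L.FG
  finrank_span : Module.finrank K (Submodule.span K (L : Set (Row K))) = 2

/-- `L` has (Steinitz) class `c`: `L ≅ 𝓞_K ⊕ 𝔞` as `𝓞_K`-modules for some ideal `𝔞` of class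
`c`. -/
def HasClass (L : Submodule (𝓞 K) (Row K)) (c : ClassGroup (𝓞 K)) : Prop :=
  ∃ 𝔞 : NzIdeal K, ClassGroup.mk0 𝔞 = c ∧
    Nonempty (L ≃ₗ[𝓞 K] (𝓞 K × (𝔞 : Ideal (𝓞 K))))

/-- The lattice `L U`, for `U ∈ 𝒢` acting on row vectors from the right. -/
def mulRight (L : Submodule (𝓞 K) (Row K)) (U : G K) : Submodule (𝓞 K) (Row K) :=
  L.map ((Matrix.vecMulLinear (U : Matrix (Fin 2) (Fin 2) (Khat K))).restrictScalars (𝓞 K))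

/-- The `𝓞_K`-submodule `𝔞 ⊕ 𝔟` of `K ⊕ K ⊆ K̂²`, for fractional ideals `𝔞` and `𝔟`. -/
def dsum (𝔞 𝔟 : FractionalIdeal (𝓞 K)⁰ K) : Submodule (𝓞 K) (Row K) where
  carrier := {v | ∃ x ∈ 𝔞, ∃ y ∈ 𝔟, v = ![algebraMap K (Khat K) x, algebraMap K (Khat K) y]}
  add_mem' := by
    rintro _ _ ⟨x, hx, y, hy, rfl⟩ ⟨x', hx', y', hy', rfl⟩
    exact ⟨x + x', (𝔞 : Submodule (𝓞 K) K).add_mem hx hx', y + y',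
      (𝔟 : Submodule (𝓞 K) K).add_mem hy hy', by simp [TensorProduct.add_tmul]⟩
  zero_mem' := ⟨0, (𝔞 : Submodule (𝓞 K) K).zero_mem, 0, (𝔟 : Submodule (𝓞 K) K).zero_mem, by
    ext i; fin_cases i <;> simp⟩
  smul_mem' := by
    rintro r _ ⟨x, hx, y, hy, rfl⟩
    refine ⟨r • x, (𝔞 : Submodule (𝓞 K) K).smul_mem r hx, r • y,
      (𝔟 : Submodule (𝓞 K) K).smul_mem r hy, ?_⟩
    ext i
    fin_cases i <;> simp [TensorProduct.smul_tmul']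

/-- A modular point for `Γ₀(𝔫)`: a pair of lattices `L ⊆ L'` with `L'/L ≅ 𝓞_K/𝔫`. -/
structure IsModularPoint (𝔫 : NzIdeal K)
    (P : Submodule (𝓞 K) (Row K) × Submodule (𝓞 K) (Row K)) : Prop where
  lattice_fst : IsLattice P.1
  lattice_snd : IsLattice P.2
  le : P.1 ≤ P.2
  quot : Nonempty ((P.2 ⧸ P.1.submoduleOf P.2) ≃ₗ[𝓞 K] (𝓞 K ⧸ (𝔫 : Ideal (𝓞 K))))

/-- The set `𝓜₀(𝔫)` of modular points for `Γ₀(𝔫)`. -/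
def M₀ (𝔫 : NzIdeal K) : Set (Submodule (𝓞 K) (Row K) × Submodule (𝓞 K) (Row K)) :=
  {P | IsModularPoint 𝔫 P}

/-- The set `𝓜₀^{(c)}(𝔫)` of modular points whose underlying lattice has class `c`. -/
def M₀Class (𝔫 : NzIdeal K) (c : ClassGroup (𝓞 K)) :
    Set (Submodule (𝓞 K) (Row K) × Submodule (𝓞 K) (Row K)) :=
  {P | P ∈ M₀ 𝔫 ∧ HasClass P.1 c}

/-- `P U = (L U, L' U)` for a pair `P = (L, L')`. -/
def pairMul (P : Submodule (𝓞 K) (Row K) × Submodule (𝓞 K) (Row K)) (U : G K) :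
    Submodule (𝓞 K) (Row K) × Submodule (𝓞 K) (Row K) :=
  (mulRight P.1 U, mulRight P.2 U)

/-- The group `Γ₀^𝔭(𝔫)` of matrices `(a b; c d)` over `K` with `a, d ∈ 𝓞_K`, `b ∈ 𝔭⁻¹`, `c ∈ 𝔫𝔭`
and `ad - bc ∈ 𝓞_Kˣ`. -/
def Γ₀ (𝔭 𝔫 : NzIdeal K) : Subgroup (Matrix.GeneralLinearGroup (Fin 2) K) where
  carrier := {γ | γ 0 0 ∈ (1 : FractionalIdeal (𝓞 K)⁰ K) ∧ γ 1 1 ∈ (1 : FractionalIdeal (𝓞 K)⁰ K) ∧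
    γ 0 1 ∈ 𝔭.frac⁻¹ ∧ γ 1 0 ∈ 𝔫.frac * 𝔭.frac ∧
    ∃ u : (𝓞 K)ˣ, γ 0 0 * γ 1 1 - γ 0 1 * γ 1 0 = algebraMap (𝓞 K) K u}
  mul_mem' := by
    rintro γ δ ⟨ha, hd, hb, hc, u, hu⟩ ⟨ha', hd', hb', hc', u', hu'⟩
    have hle : 𝔫.frac ≤ 1 := FractionalIdeal.coeIdeal_le_one
    have hbc : ∀ {x y : K}, x ∈ 𝔭.frac⁻¹ → y ∈ 𝔫.frac * 𝔭.frac →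
        x * y ∈ (1 : FractionalIdeal (𝓞 K)⁰ K) := by
      intro x y hx hy
      have h := FractionalIdeal.mul_mem_mul hx hy
      rw [mul_comm 𝔫.frac, ← mul_assoc, inv_mul_cancel₀ 𝔭.frac_ne_zero, one_mul] at h
      exact hle h
    have h11 : ∀ {I : FractionalIdeal (𝓞 K)⁰ K} {x y : K},
        x ∈ (1 : FractionalIdeal (𝓞 K)⁰ K) → y ∈ I → x * y ∈ I := by
      intro I x y hx hy
      have h := FractionalIdeal.mul_mem_mul hx hy
      rwa [one_mul] at h
    have hadd : ∀ {I : FractionalIdeal (𝓞 K)⁰ K} {x y : K}, x ∈ I → y ∈ I → x + y ∈ I :=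
      fun {I} {_ _} hx hy => (I : Submodule (𝓞 K) K).add_mem hx hy
    simp only [Set.mem_ofPred_eq, Units.val_mul, Matrix.mul_apply, Fin.sum_univ_two]
    refine ⟨hadd (h11 ha ha') (hbc hb hc'), hadd ?_ (h11 hd hd'), hadd (h11 ha hb') ?_,
      hadd ?_ (h11 hd hc'), u * u', ?_⟩
    · rw [mul_comm]; exact hbc hb' hc
    · rw [mul_comm]; exact h11 hd' hb
    · rw [mul_comm (γ 1 0)]; exact h11 ha' hc
    · rw [Units.val_mul, map_mul, ← hu, ← hu']; ring
  one_mem' := by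
    refine ⟨?_, ?_, ?_, ?_, 1, ?_⟩
    · simp
    · simp
    · simpa using (𝔭.frac⁻¹ : FractionalIdeal (𝓞 K)⁰ K).zero_mem
    · simpa using (𝔫.frac * 𝔭.frac : FractionalIdeal (𝓞 K)⁰ K).zero_mem
    · simp
  inv_mem' := by
    rintro γ ⟨ha, hd, hb, hc, u, hu⟩
    have hdet : (γ : Matrix (Fin 2) (Fin 2) K).det = algebraMap (𝓞 K) K u := by
      rw [Matrix.det_fin_two, hu]
    have hinv : (γ : Matrix (Fin 2) (Fin 2) K).det⁻¹ = algebraMap (𝓞 K) K ↑u⁻¹ := by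
      rw [hdet]
      refine inv_eq_of_mul_eq_one_left ?_
      rw [← map_mul, Units.inv_mul, map_one]
    have hsm : ∀ {I : FractionalIdeal (𝓞 K)⁰ K} {x : K}, x ∈ I →
        algebraMap (𝓞 K) K ↑u⁻¹ * x ∈ I := by
      intro I x hx
      rw [← Algebra.smul_def]
      exact (I : Submodule (𝓞 K) K).smul_mem _ hx
    have hneg : ∀ {I : FractionalIdeal (𝓞 K)⁰ K} {x : K}, x ∈ I → -x ∈ I :=
      fun {I} {_} hx => (I : Submodule (𝓞 K) K).neg_mem hx
    have hmat : ((γ⁻¹ : Matrix.GeneralLinearGroup (Fin 2) K) : Matrix (Fin 2) (Fin 2) K) =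
        algebraMap (𝓞 K) K ↑u⁻¹ • !![γ 1 1, -γ 0 1; -γ 1 0, γ 0 0] := by
      rw [Matrix.coe_units_inv, Matrix.inv_def, Ring.inverse_eq_inv', hinv, Matrix.adjugate_fin_two]
    simp only [Set.mem_ofPred_eq, hmat]
    refine ⟨by simpa using hsm hd, by simpa using hsm ha, by simpa using hneg (hsm hb),
      by simpa using hneg (hsm hc), u⁻¹, ?_⟩
    have h1 : algebraMap (𝓞 K) K ↑u⁻¹ * algebraMap (𝓞 K) K u = 1 := by
      rw [← map_mul, Units.inv_mul, map_one]
    simp only [Matrix.smul_apply, Matrix.of_apply, Matrix.cons_val', Matrix.cons_val_zero,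
      Matrix.cons_val_one, Matrix.cons_val_fin_one, smul_eq_mul]
    linear_combination (algebraMap (𝓞 K) K ↑u⁻¹) ^ 2 * hu + algebraMap (𝓞 K) K ↑u⁻¹ * h1

/-- `Γ₀^𝔭(𝔫)` as a subgroup of `𝒢`, through the diagonal embedding of `K` in `K̂`. -/
def Γ₀hat (𝔭 𝔫 : NzIdeal K) : Subgroup (G K) :=
  (Γ₀ 𝔭 𝔫).map (Matrix.GeneralLinearGroup.map (algebraMap K (Khat K)))

end Basic

/-- A choice of ideals `𝔭 i` whose classes represent the cosets of the subgroup of squares in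
the class group, and ideals `𝔮 j` such that the `[𝔮 j]²` are the squares, each taken once. -/
structure ClassReps (K : Type*) [Field K] [NumberField K] (ι κ : Type*) where
  𝔭 : ι → NzIdeal K
  𝔮 : κ → NzIdeal K
  𝔭_bijective : Function.Bijective fun i =>
    (QuotientGroup.mk (ClassGroup.mk0 (𝔭 i)) :
      ClassGroup (𝓞 K) ⧸ (powMonoidHom 2 : ClassGroup (𝓞 K) →* ClassGroup (𝓞 K)).range)
  𝔮_sq_bijOn : Set.BijOn (fun j => ClassGroup.mk0 (𝔮 j) ^ 2) Set.univ
    {c : ClassGroup (𝓞 K) | IsSquare c}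

namespace ClassReps

variable {K : Type*} [Field K] [NumberField K] {ι κ : Type*} (R : ClassReps K ι κ)

/-- The class `c_{ij} = [𝔭_i][𝔮_j]²`. -/
def c (i : ι) (j : κ) : ClassGroup (𝓞 K) :=
  ClassGroup.mk0 (R.𝔭 i) * ClassGroup.mk0 (R.𝔮 j) ^ 2

/-- The standard modular point `P_{ij} = (𝔭_i𝔮_j ⊕ 𝔮_j, 𝔭_i𝔮_j ⊕ 𝔮_j𝔫⁻¹)`. -/
def stdPoint (𝔫 : NzIdeal K) (i : ι) (j : κ) :
    Submodule (𝓞 K) (Row K) × Submodule (𝓞 K) (Row K) :=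
  (dsum ((R.𝔭 i).frac * (R.𝔮 j).frac) (R.𝔮 j).frac,
    dsum ((R.𝔭 i).frac * (R.𝔮 j).frac) ((R.𝔮 j).frac * 𝔫.frac⁻¹))

/-- `U` is an admissible basis matrix for the modular point `P` of class `c_{ij}`:
`P = P_{ij} U`. -/
def IsAdmissible (𝔫 : NzIdeal K) (i : ι) (j : κ)
    (P : Submodule (𝓞 K) (Row K) × Submodule (𝓞 K) (Row K)) (U : G K) : Prop :=
  P = pairMul (R.stdPoint 𝔫 i j) U

end ClassReps

end ModPt

end

namespace ModPt

/-! ### Fractional ideals of a Dedekind domain: multipliers, and unimodular rows lifted from a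
quotient. -/

section FractionalIdeals

/-! A `K`-basis of `KL` moves any lattice into `K²`. There it splits, because its projection to the
first coordinate is a fractional ideal and so projective. Hence every lattice is `(I₁ ⊕ I₂)U`. Its
class is that of `I₁I₂`: a determinant-one matrix turns `I₁ ⊕ I₂` into `I₁I₂ ⊕ 1`, and the
determinant of an isomorphism scales one product of ideals onto the other. Reducing a class modulo
squares gives `i`, and the remaining square gives `j`.

The heart is the existence of an admissible basis matrix, an elementary divisor theorem for `L ⊆ L'`
with cyclic quotient (`exists_mulRight_pair_eq`). Write `L' = I₁ ⊕ I₂` and fix any nonzero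
fractional ideal `J`. Since `L'/L ≅ 𝓞_K/𝔫 ≅ J/𝔫J` and `L'` is projective, the quotient map lifts to
a functional `(x, y) ↦ αx + βy` from `L'` to `J`, and `L` is the preimage of `𝔫J`. The functional
need only be surjective modulo `𝔫`, but `exists_unimodular` alters `α, β` modulo `𝔫` to make it
surjective. It is then the second column of a matrix of determinant one, which carries `L'` to
`I₁I₂J⁻¹ ⊕ J` and `L` to `I₁I₂J⁻¹ ⊕ 𝔫J`. With `J = 𝔮_j𝔫⁻¹` this is `P_{ij}` up to the first summand,
and the class condition makes that summand a scalar multiple of `𝔭_i𝔮_j`, so a diagonal matrix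
finishes.

Two matrices give the same point when their quotient fixes `P_{ij}`. A stabilizing matrix has
entries in `K`, and the inclusions it respects are the conditions defining `Γ₀^𝔭(𝔫)`
(`mem_Γ₀_iff_pairMul_eq`). The remaining statements are formal consequences. -/

theorem exists_ne_zero_mem {R F : Type*} [CommRing R] [Field F] [Algebra R F]
    {A : FractionalIdeal R⁰ F} (hA : A ≠ 0) : ∃ x ∈ A, x ≠ 0 := by
  by_contra! h
  exact hA (FractionalIdeal.eq_zero_iff.2 h)

variable {R F : Type*} [CommRing R] [IsDedekindDomain R] [Field F] [Algebra R F]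
  [IsFractionRing R F]

open FractionalIdeal

theorem mem_mul_inv_iff {A B : FractionalIdeal R⁰ F} (hA : A ≠ 0) {c : F} :
    c ∈ B * A⁻¹ ↔ ∀ x ∈ A, c * x ∈ B := by
  rw [← div_eq_mul_inv, FractionalIdeal.mem_div_iff_of_ne_zero hA]

/-- For a fixed nonzero `a ∈ A`, any `x ∈ A` satisfies `s x = r a` with `s ≠ 0`, so `f x` is
determined by `f a` and the multiplier is `f a / a`. -/
theorem exists_forall_eq_mul {A : FractionalIdeal R⁰ F}
    (f : (A : Submodule R F) →ₗ[R] F) : ∃ c : F, ∀ x, f x = c * x := by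
  by_cases hA : A = 0
  · subst hA
    refine ⟨0, fun x => ?_⟩
    have hx : x = 0 := by
      exact Subtype.ext ((FractionalIdeal.mem_zero_iff R⁰).1 x.2)
    simp [hx]
  obtain ⟨a, ha, ha0⟩ := exists_ne_zero_mem hA
  refine ⟨f ⟨a, ha⟩ / a, fun x => ?_⟩
  obtain ⟨r, s, hs, hrs⟩ := IsFractionRing.div_surjective (A := R) ((x : F) / a)
  have hs0 : algebraMap R F s ≠ 0 :=
    IsFractionRing.to_map_ne_zero_of_mem_nonZeroDivisors hs
  have hx : s • x = r • (⟨a, ha⟩ : (A : Submodule R F)) := by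
    apply Subtype.ext
    simp only [Submodule.coe_smul, Algebra.smul_def]
    field_simp at hrs
    linear_combination -hrs
  have h := congrArg f hx
  rw [map_smul, map_smul, Algebra.smul_def, Algebra.smul_def] at h
  have h2 := congrArg Subtype.val hx
  simp only [Submodule.coe_smul, Algebra.smul_def] at h2
  apply mul_left_cancel₀ hs0
  rw [h]
  field_simp
  linear_combination -f ⟨a, ha⟩ * h2

/-- Chinese remaindering: only finitely many primes contain `a`, and those not containing `n` have a
product coprime to `n`. So `β` can be kept modulo `nN` while being replaced by a local generator of
`N` at those primes. -/
theorem exists_sub_mem_forall_notMem {a n : Ideal R} (ha : a ≠ ⊥)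
    {N : FractionalIdeal R⁰ F} (hN : N ≠ 0) {β : F} (hβ : β ∈ N)
    (h : ∀ P : Ideal R, P.IsMaximal → a ≤ P → n ≤ P → β ∉ (P : FractionalIdeal R⁰ F) * N) :
    ∃ β' ∈ N, β' - β ∈ (n : FractionalIdeal R⁰ F) * N ∧
      ∀ P : Ideal R, P.IsMaximal → a ≤ P → β' ∉ (P : FractionalIdeal R⁰ F) * N := by
  classical
  have hfin : {P : Ideal R | P.IsMaximal ∧ a ≤ P ∧ ¬ n ≤ P}.Finite := by
    have := UniqueFactorizationMonoid.fintypeSubtypeDvd a ha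
    have hdvd : Finite {P : Ideal R // P ∣ a} := inferInstance
    refine (Set.finite_coe_iff (s := {P : Ideal R | P ∣ a}).1 hdvd).subset ?_
    rintro P ⟨-, hP, -⟩
    exact Ideal.dvd_iff_le.2 hP
  set S := hfin.toFinset with hS
  set a' : Ideal R := ∏ P ∈ S, P with ha'
  have hmem : ∀ P, P ∈ S ↔ P.IsMaximal ∧ a ≤ P ∧ ¬ n ≤ P := by
    intro P; simp [hS]
  have ha'0 : a' ≠ 0 := by
    rw [ha', Finset.prod_ne_zero_iff]
    intro P hP hP0
    apply ha
    rw [eq_bot_iff]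
    exact (((hmem P).1 hP).2.1).trans (le_of_eq hP0)
  have hle : ∀ P ∈ S, a' ≤ P := fun P hP => Ideal.dvd_iff_le.1 (Finset.dvd_prod_of_mem _ hP)
  have hcop : n ⊔ a' = ⊤ := by
    by_contra hne
    obtain ⟨P, hP, hPle⟩ := Ideal.exists_le_maximal _ hne
    have h1 : a' ≤ P := le_sup_right.trans hPle
    obtain ⟨Q, hQ, hQP⟩ := (Ideal.IsPrime.prod_le hP.isPrime).1 h1
    have hQ' := (hmem Q).1 hQ
    have : Q = P := hQ'.1.eq_of_le hP.ne_top hQP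
    subst this
    exact hQ'.2.2 (le_sup_left.trans hPle)
  obtain ⟨ε, hε, δ, hδ, hεδ⟩ := Submodule.mem_sup.1 ((Ideal.eq_top_iff_one _).1 hcop)
  have hlt : (a' : FractionalIdeal R⁰ F) * N ≤ N := by
    calc (a' : FractionalIdeal R⁰ F) * N ≤ 1 * N := by gcongr; exact coeIdeal_le_one
      _ = N := one_mul N
  -- From `a'N + (β₁) = N` it follows that `β₁ ∉ PN` for every `P` in `S`.
  obtain ⟨β₁, hβ₁⟩ := IsDedekindDomain.exists_add_spanSingleton_mul_eq hlt
    (mul_ne_zero (coeIdeal_ne_zero.2 ha'0) hN) (one_ne_zero (α := FractionalIdeal R⁰ F))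
  rw [mul_one] at hβ₁
  have hβ₁N : β₁ ∈ N := by
    rw [← spanSingleton_le_iff_mem, ← hβ₁, ← FractionalIdeal.sup_eq_add]
    exact le_sup_right
  have hadd : ∀ {I : FractionalIdeal R⁰ F} {x y : F}, x ∈ I → y ∈ I → x + y ∈ I :=
    fun {I} {_ _} hx hy => (I : Submodule R F).add_mem hx hy
  have hsub : ∀ {I : FractionalIdeal R⁰ F} {x y : F}, x ∈ I → y ∈ I → x - y ∈ I :=
    fun {I} {_ _} hx hy => (I : Submodule R F).sub_mem hx hy
  have hed : algebraMap R F ε + algebraMap R F δ = 1 := by rw [← map_add, hεδ, map_one]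
  have key : ∀ {I : Ideal R} {r : R} {x : F}, r ∈ I → x ∈ N →
      algebraMap R F r * x ∈ (I : FractionalIdeal R⁰ F) * N := fun {I r x} hr hx =>
    FractionalIdeal.mul_mem_mul (mem_coeIdeal_of_mem _ hr) hx
  -- This is `δβ + εβ₁`, congruent to `β` modulo `nN` and to `β₁` modulo `a'N`.
  refine ⟨β + algebraMap R F ε * (β₁ - β), ?_, ?_, ?_⟩
  · exact hadd hβ (by
      rw [← Algebra.smul_def]
      exact (N : Submodule R F).smul_mem _ (hsub hβ₁N hβ))
  · rw [add_sub_cancel_left]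
    exact key hε (hsub hβ₁N hβ)
  · intro P hP haP hmemP
    by_cases hnP : n ≤ P
    · refine h P hP haP hnP ?_
      have := hsub hmemP (key (hnP hε) (hsub hβ₁N hβ))
      rwa [add_sub_cancel_right] at this
    · have haP' := hle P ((hmem P).2 ⟨hP, haP, hnP⟩)
      have h2 := hadd hmemP (key (haP' hδ) (hsub hβ₁N hβ))
      have h3 : β₁ ∈ (P : FractionalIdeal R⁰ F) * N := by
        convert h2 using 1
        linear_combination (β - β₁) * hed
      have h4 : N ≤ (P : FractionalIdeal R⁰ F) * N := by
        refine hβ₁.symm.le.trans ?_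
        rw [← FractionalIdeal.sup_eq_add]
        refine sup_le ?_ ?_
        · gcongr
        · rw [spanSingleton_le_iff_mem]; exact h3
      have h5 : (1 : FractionalIdeal R⁰ F) ≤ P := by
        have := mul_le_mul_left h4 N⁻¹
        rwa [mul_assoc, mul_inv_cancel₀ hN, mul_one] at this
      apply hP.ne_top
      rw [← coeIdeal_top, coeIdeal_le_coeIdeal] at h5
      exact top_le_iff.1 h5

/-- Two fractional multipliers that are jointly surjective modulo `n` can be changed modulo `n`
so that they become jointly surjective. -/
theorem exists_unimodular {n : Ideal R} (hn : n ≠ ⊥) {I₁ I₂ J : FractionalIdeal R⁰ F}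
    (h₁ : I₁ ≠ 0) (h₂ : I₂ ≠ 0) (hJ : J ≠ 0) {α β : F} (hα : α ∈ J * I₁⁻¹) (hβ : β ∈ J * I₂⁻¹)
    (hsurj : ∀ z ∈ J, ∃ x ∈ I₁, ∃ y ∈ I₂,
      z - (α * x + β * y) ∈ (n : FractionalIdeal R⁰ F) * J) :
    ∃ α' ∈ J * I₁⁻¹, ∃ β' ∈ J * I₂⁻¹,
      α' - α ∈ (n : FractionalIdeal R⁰ F) * (J * I₁⁻¹) ∧
      β' - β ∈ (n : FractionalIdeal R⁰ F) * (J * I₂⁻¹) ∧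
      ∃ s ∈ I₁ * J⁻¹, ∃ t ∈ I₂ * J⁻¹, α' * s + β' * t = 1 := by
  have hadd : ∀ {I : FractionalIdeal R⁰ F} {x y : F}, x ∈ I → y ∈ I → x + y ∈ I :=
    fun {I} {_ _} hx hy => (I : Submodule R F).add_mem hx hy
  have hsub : ∀ {I : FractionalIdeal R⁰ F} {x y : F}, x ∈ I → y ∈ I → x - y ∈ I :=
    fun {I} {_ _} hx hy => (I : Submodule R F).sub_mem hx hy
  have hnN : ∀ {I : FractionalIdeal R⁰ F}, (n : FractionalIdeal R⁰ F) * I ≤ I := fun {I} => by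
    calc (n : FractionalIdeal R⁰ F) * I ≤ 1 * I := by gcongr; exact coeIdeal_le_one
      _ = I := one_mul I
  have hn0 : (n : FractionalIdeal R⁰ F) ≠ 0 := coeIdeal_ne_zero.2 hn
  have hN₁ : J * I₁⁻¹ ≠ 0 := mul_ne_zero hJ (inv_ne_zero h₁)
  have hN₂ : J * I₂⁻¹ ≠ 0 := mul_ne_zero hJ (inv_ne_zero h₂)
  -- a nonzero first multiplier
  obtain ⟨α', hα', hα'α, hα'0⟩ : ∃ α' ∈ J * I₁⁻¹,
      α' - α ∈ (n : FractionalIdeal R⁰ F) * (J * I₁⁻¹) ∧ α' ≠ 0 := by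
    by_cases h0 : α = 0
    · obtain ⟨x, hx, hx0⟩ := exists_ne_zero_mem (mul_ne_zero hn0 hN₁)
      exact ⟨x, hnN hx, by simpa [h0] using hx, hx0⟩
    · exact ⟨α, hα, by rw [sub_self]; exact Submodule.zero_mem _, h0⟩
  have hle : ∀ {c : F} {I : FractionalIdeal R⁰ F}, I ≠ 0 → c ∈ J * I⁻¹ →
      spanSingleton R⁰ c * (I * J⁻¹) ≤ 1 := by
    intro c I hI hc
    calc spanSingleton R⁰ c * (I * J⁻¹) ≤ (J * I⁻¹) * (I * J⁻¹) := by
          gcongr; rwa [spanSingleton_le_iff_mem]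
      _ = (J * J⁻¹) * (I⁻¹ * I) := by ring
      _ = 1 := by rw [mul_inv_cancel₀ hJ, inv_mul_cancel₀ hI, one_mul]
  -- The integral ideal `a = α'I₁J⁻¹` is nonzero, so only finitely many primes can obstruct; `β` is
  -- adjusted to avoid them all.
  obtain ⟨a, ha⟩ := le_one_iff_exists_coeIdeal.1 (hle h₁ hα')
  have ha0 : a ≠ ⊥ := by
    rw [← coeIdeal_ne_zero (K := F), ha]
    exact mul_ne_zero (spanSingleton_ne_zero_iff.2 hα'0) (mul_ne_zero h₁ (inv_ne_zero hJ))
  have hdiv : ∀ {c : F} {I : FractionalIdeal R⁰ F} {P : Ideal R}, I ≠ 0 →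
      spanSingleton R⁰ c * (I * J⁻¹) ≤ P → c ∈ (P : FractionalIdeal R⁰ F) * (J * I⁻¹) := by
    intro c I P hI h
    have := mul_le_mul_left h (J * I⁻¹)
    rw [show spanSingleton R⁰ c * (I * J⁻¹) * (J * I⁻¹) =
      spanSingleton R⁰ c * ((J⁻¹ * J) * (I * I⁻¹)) by ring, mul_inv_cancel₀ hI,
      inv_mul_cancel₀ hJ, one_mul, mul_one, spanSingleton_le_iff_mem] at this
    exact this
  obtain ⟨β', hβ', hβ'β, hP⟩ := exists_sub_mem_forall_notMem (n := n) ha0 hN₂ hβ (by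
    intro P hP haP hnP hβP
    have h1 : α' ∈ (P : FractionalIdeal R⁰ F) * (J * I₁⁻¹) := by
      apply hdiv h₁
      rw [← ha]
      exact (coeIdeal_le_coeIdeal F).2 haP
    have hnP' : (n : FractionalIdeal R⁰ F) ≤ P := (coeIdeal_le_coeIdeal F).2 hnP
    have h2 : α ∈ (P : FractionalIdeal R⁰ F) * (J * I₁⁻¹) := by
      have h3 : α' - α ∈ (P : FractionalIdeal R⁰ F) * (J * I₁⁻¹) :=
        (by gcongr : (n : FractionalIdeal R⁰ F) * (J * I₁⁻¹) ≤ P * (J * I₁⁻¹)) hα'α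
      have := hsub h1 h3
      rwa [sub_sub_cancel] at this
    -- If both multipliers were divisible by a prime `P` containing `n`, the functional would land
    -- in `PJ`, against surjectivity modulo `n`.
    have hJP : J ≤ P * J := by
      intro z hz
      obtain ⟨x, hx, y, hy, hxy⟩ := hsurj z hz
      have h4 : z - (α * x + β * y) ∈ (P : FractionalIdeal R⁰ F) * J :=
        (by gcongr : (n : FractionalIdeal R⁰ F) * J ≤ P * J) hxy
      rw [← mul_assoc] at h2 hβP
      have := hadd h4 (hadd ((mem_mul_inv_iff h₁).1 h2 x hx) ((mem_mul_inv_iff h₂).1 hβP y hy))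
      rwa [sub_add_cancel] at this
    have h5 : (1 : FractionalIdeal R⁰ F) ≤ P := by
      have := mul_le_mul_left hJP J⁻¹
      rwa [mul_assoc, mul_inv_cancel₀ hJ, mul_one] at this
    apply hP.ne_top
    rw [← coeIdeal_top, coeIdeal_le_coeIdeal] at h5
    exact top_le_iff.1 h5)
  refine ⟨α', hα', β', hβ', hα'α, hβ'β, ?_⟩
  obtain ⟨b, hb⟩ := le_one_iff_exists_coeIdeal.1 (hle h₂ hβ')
  have htop : a ⊔ b = ⊤ := by
    by_contra hne
    obtain ⟨P, hPm, hPle⟩ := Ideal.exists_le_maximal _ hne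
    refine hP P hPm (le_sup_left.trans hPle) (hdiv h₂ ?_)
    rw [← hb]
    exact (coeIdeal_le_coeIdeal F).2 (le_sup_right.trans hPle)
  obtain ⟨u, hu, v, hv, huv⟩ := Submodule.mem_sup.1 ((Ideal.eq_top_iff_one _).1 htop)
  have hu' := mem_coeIdeal_of_mem R⁰ (P := F) hu
  have hv' := mem_coeIdeal_of_mem R⁰ (P := F) hv
  rw [ha, mem_singleton_mul] at hu'
  rw [hb, mem_singleton_mul] at hv'
  obtain ⟨s, hs, hs'⟩ := hu'
  obtain ⟨t, ht, ht'⟩ := hv'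
  exact ⟨s, hs, t, ht, by rw [← hs', ← ht', ← map_add, huv, map_one]⟩

end FractionalIdeals

/-! ### Invariance of the Steinitz class. -/

section Steinitz

variable {R F : Type*} [CommRing R] [IsDedekindDomain R] [Field F] [Algebra R F]
  [IsFractionRing R F]

open FractionalIdeal

theorem exists_matrix_of_linearMap {A B A' B' : FractionalIdeal R⁰ F}
    (f : (↥(A : Submodule R F) × ↥(B : Submodule R F)) →ₗ[R]
      (↥(A' : Submodule R F) × ↥(B' : Submodule R F))) :
    ∃ a b c d : F, ∀ v, ((f v).1 : F) = a * v.1 + b * v.2 ∧ ((f v).2 : F) = c * v.1 + d * v.2 := by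
  obtain ⟨a, ha⟩ := exists_forall_eq_mul
    ((A' : Submodule R F).subtype ∘ₗ LinearMap.fst R _ _ ∘ₗ f ∘ₗ LinearMap.inl R _ _)
  obtain ⟨b, hb⟩ := exists_forall_eq_mul
    ((A' : Submodule R F).subtype ∘ₗ LinearMap.fst R _ _ ∘ₗ f ∘ₗ LinearMap.inr R _ _)
  obtain ⟨c, hc⟩ := exists_forall_eq_mul
    ((B' : Submodule R F).subtype ∘ₗ LinearMap.snd R _ _ ∘ₗ f ∘ₗ LinearMap.inl R _ _)
  obtain ⟨d, hd⟩ := exists_forall_eq_mul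
    ((B' : Submodule R F).subtype ∘ₗ LinearMap.snd R _ _ ∘ₗ f ∘ₗ LinearMap.inr R _ _)
  refine ⟨a, b, c, d, fun v => ?_⟩
  have hv : f v = f (v.1, 0) + f (0, v.2) := by rw [← map_add]; simp
  rw [← ha, ← hb, ← hc, ← hd, hv]
  simp

/-- On products, `(ad - bc)xy = (ax)(dy) - (by)(cx)`, and both terms lie in `A'B'`. -/
theorem spanSingleton_det_mul_le {R F : Type*} [CommRing R] [IsDomain R] [Field F] [Algebra R F]
    [IsFractionRing R F] {A B A' B' : FractionalIdeal R⁰ F} {a b c d : F}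
    (ha : ∀ x ∈ A, a * x ∈ A') (hb : ∀ y ∈ B, b * y ∈ A') (hc : ∀ x ∈ A, c * x ∈ B')
    (hd : ∀ y ∈ B, d * y ∈ B') :
    spanSingleton R⁰ (a * d - b * c) * (A * B) ≤ A' * B' := by
  rw [← mul_assoc, FractionalIdeal.mul_le]
  intro z hz y hy
  obtain ⟨x, hx, rfl⟩ := mem_singleton_mul.1 hz
  have h1 := FractionalIdeal.mul_mem_mul (ha x hx) (hd y hy)
  have h2 := FractionalIdeal.mul_mem_mul (hb y hy) (hc x hx)
  rw [show (a * d - b * c) * x * y = a * x * (d * y) - b * y * (c * x) by ring]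
  exact ((A' * B' : FractionalIdeal R⁰ F) : Submodule R F).sub_mem h1 h2

/-- The Steinitz class is an isomorphism invariant. -/
theorem exists_mul_eq_of_linearEquiv {A B A' B' : FractionalIdeal R⁰ F}
    (hA : A ≠ 0) (hB : B ≠ 0)
    (e : (↥(A : Submodule R F) × ↥(B : Submodule R F)) ≃ₗ[R]
      (↥(A' : Submodule R F) × ↥(B' : Submodule R F))) :
    ∃ x : F, x ≠ 0 ∧ spanSingleton R⁰ x * (A * B) = A' * B' := by
  obtain ⟨a, b, c, d, he⟩ := exists_matrix_of_linearMap e.toLinearMap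
  obtain ⟨a', b', c', d', he'⟩ := exists_matrix_of_linearMap e.symm.toLinearMap
  simp only [LinearEquiv.coe_coe] at he he'
  have h := spanSingleton_det_mul_le (A := A) (B := B) (A' := A') (B' := B') (a := a) (b := b)
    (c := c) (d := d)
    (fun x hx => by have := (he (⟨x, hx⟩, 0)).1; simp at this; rw [← this]; exact Subtype.mem _)
    (fun x hx => by have := (he (0, ⟨x, hx⟩)).1; simp at this; rw [← this]; exact Subtype.mem _)
    (fun x hx => by have := (he (⟨x, hx⟩, 0)).2; simp at this; rw [← this]; exact Subtype.mem _)
    (fun x hx => by have := (he (0, ⟨x, hx⟩)).2; simp at this; rw [← this]; exact Subtype.mem _)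
  have h' := spanSingleton_det_mul_le (A := A') (B := B') (A' := A) (B' := B) (a := a') (b := b')
    (c := c') (d := d')
    (fun x hx => by have := (he' (⟨x, hx⟩, 0)).1; simp at this; rw [← this]; exact Subtype.mem _)
    (fun x hx => by have := (he' (0, ⟨x, hx⟩)).1; simp at this; rw [← this]; exact Subtype.mem _)
    (fun x hx => by have := (he' (⟨x, hx⟩, 0)).2; simp at this; rw [← this]; exact Subtype.mem _)
    (fun x hx => by have := (he' (0, ⟨x, hx⟩)).2; simp at this; rw [← this]; exact Subtype.mem _)
  obtain ⟨x, hx, hx0⟩ := exists_ne_zero_mem hA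
  obtain ⟨y, hy, hy0⟩ := exists_ne_zero_mem hB
  -- Testing `e⁻¹ ∘ e = id` on one nonzero vector of each summand shows that the two matrices are
  -- inverse over `F`, so the two determinant inclusions are reverse to each other.
  have comp : ∀ v : ↥(A : Submodule R F) × ↥(B : Submodule R F), (v.1 : F) = a' * (a * v.1 + b * v.2) + b' * (c * v.1 + d * v.2) ∧
      (v.2 : F) = c' * (a * v.1 + b * v.2) + d' * (c * v.1 + d * v.2) := by
    intro v
    have := he' (e v)
    rwa [e.symm_apply_apply, (he v).1, (he v).2] at this
  have hx1 := comp (⟨x, hx⟩, 0)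
  have hy1 := comp (0, ⟨y, hy⟩)
  simp only [ZeroMemClass.coe_zero, mul_zero, add_zero, zero_add] at hx1 hy1
  have e1 : a' * a + b' * c = 1 := mul_right_cancel₀ hx0 (by linear_combination -hx1.1)
  have e2 : c' * a + d' * c = 0 := mul_right_cancel₀ hx0 (by linear_combination -hx1.2)
  have e3 : a' * b + b' * d = 0 := mul_right_cancel₀ hy0 (by linear_combination -hy1.1)
  have e4 : c' * b + d' * d = 1 := mul_right_cancel₀ hy0 (by linear_combination -hy1.2)
  have hdet : (a * d - b * c) * (a' * d' - b' * c') = 1 := by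
    linear_combination (c' * b + d' * d) * e1 + e4 - (a' * b + b' * d) * e2
  refine ⟨a * d - b * c, left_ne_zero_of_mul_eq_one hdet, le_antisymm h ?_⟩
  calc A' * B' = spanSingleton R⁰ (a * d - b * c) *
        (spanSingleton R⁰ (a' * d' - b' * c') * (A' * B')) := by
        rw [← mul_assoc, spanSingleton_mul_spanSingleton, hdet, spanSingleton_one, one_mul]
    _ ≤ _ := by gcongr

end Steinitz

/-! ### The action of `𝒢` on sums of fractional ideals. -/

section Action

variable {K : Type*} [Field K] [NumberField K]

open FractionalIdeal

theorem mem_mulRight {L : Submodule (𝓞 K) (Row K)} {U : G K} {v : Row K} :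
    v ∈ mulRight L U ↔ Matrix.vecMul v (U⁻¹ : G K).val ∈ L := by
  constructor
  · rintro ⟨w, hw, rfl⟩
    simpa [Matrix.vecMul_vecMul] using hw
  · intro h
    exact ⟨_, h, by simp [Matrix.vecMul_vecMul]⟩

theorem vecMul_mem_mulRight {L : Submodule (𝓞 K) (Row K)} {U : G K} {v : Row K} (hv : v ∈ L) :
    Matrix.vecMul v U.val ∈ mulRight L U :=
  ⟨v, hv, rfl⟩

theorem mulRight_mul (L : Submodule (𝓞 K) (Row K)) (U V : G K) :
    mulRight L (U * V) = mulRight (mulRight L U) V := by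
  ext v
  rw [mem_mulRight, mem_mulRight, mem_mulRight, Matrix.vecMul_vecMul, mul_inv_rev]
  rfl

@[simp]
theorem mulRight_one (L : Submodule (𝓞 K) (Row K)) : mulRight L 1 = L := by
  ext v
  simp [mem_mulRight]

theorem mulRight_mono {L M : Submodule (𝓞 K) (Row K)} (h : L ≤ M) (U : G K) :
    mulRight L U ≤ mulRight M U :=
  Submodule.map_mono h

theorem mulRight_inv_eq {L M : Submodule (𝓞 K) (Row K)} {U : G K} (h : mulRight L U = M) :
    mulRight M U⁻¹ = L := by
  rw [← h, ← mulRight_mul, mul_inv_cancel, mulRight_one]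

/-- `L ≅ L U`. -/
noncomputable def mulRightEquiv (L : Submodule (𝓞 K) (Row K)) (U : G K) : L ≃ₗ[𝓞 K] mulRight L U :=
  Submodule.equivMapOfInjective _ (fun v w h => by
    have := congrArg (fun v => Matrix.vecMul v (U⁻¹ : G K).val) h
    simpa [Matrix.vecMul_vecMul] using this) L

theorem pairMul_mul (P : Submodule (𝓞 K) (Row K) × Submodule (𝓞 K) (Row K)) (U V : G K) :
    pairMul P (U * V) = pairMul (pairMul P U) V :=
  Prod.ext (mulRight_mul _ _ _) (mulRight_mul _ _ _)

@[simp]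
theorem pairMul_one (P : Submodule (𝓞 K) (Row K) × Submodule (𝓞 K) (Row K)) :
    pairMul P 1 = P :=
  Prod.ext (mulRight_one _) (mulRight_one _)

theorem algebraMap_Khat_injective : Function.Injective (algebraMap K (Khat K)) :=
  FaithfulSMul.algebraMap_injective K (Khat K)

/-- The diagonal embedding of `GL(2, K)` in `𝒢`. -/
noncomputable abbrev toHat : Matrix.GeneralLinearGroup (Fin 2) K →* G K :=
  Matrix.GeneralLinearGroup.map (algebraMap K (Khat K))

/-- The diagonal embedding of `K²` in `K̂²`. -/
noncomputable abbrev emb (x y : K) : Row K := ![algebraMap K (Khat K) x, algebraMap K (Khat K) y]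

theorem emb_inj {x y x' y' : K} : emb x y = emb x' y' ↔ x = x' ∧ y = y' := by
  constructor
  · intro h
    exact ⟨algebraMap_Khat_injective (congrFun h 0), algebraMap_Khat_injective (congrFun h 1)⟩
  · rintro ⟨rfl, rfl⟩; rfl

theorem emb_mem_dsum {A B : FractionalIdeal (𝓞 K)⁰ K} {x y : K} :
    emb x y ∈ dsum A B ↔ x ∈ A ∧ y ∈ B := by
  constructor
  · rintro ⟨x', hx', y', hy', h⟩
    obtain ⟨rfl, rfl⟩ := emb_inj.1 h
    exact ⟨hx', hy'⟩
  · rintro ⟨hx, hy⟩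
    exact ⟨x, hx, y, hy, rfl⟩

theorem emb_vecMul (x y : K) (γ : Matrix.GeneralLinearGroup (Fin 2) K) :
    Matrix.vecMul (emb x y) (toHat γ).val =
      emb (x * γ 0 0 + y * γ 1 0) (x * γ 0 1 + y * γ 1 1) := by
  ext i
  fin_cases i <;> simp [Matrix.vecMul, dotProduct, Fin.sum_univ_two, TensorProduct.add_tmul]

theorem emb_add (x y x' y' : K) : emb x y + emb x' y' = emb (x + x') (y + y') := by
  ext i; fin_cases i <;> simp [TensorProduct.add_tmul]

theorem emb_smul (r : 𝓞 K) (x y : K) : r • emb x y = emb (r • x) (r • y) := by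
  ext i; fin_cases i <;> simp [TensorProduct.smul_tmul']

/-- The linear map `𝔞 × 𝔟 → 𝔞 ⊕ 𝔟`. -/
noncomputable def dsumMap (A B : FractionalIdeal (𝓞 K)⁰ K) :
    (↥(A : Submodule (𝓞 K) K) × ↥(B : Submodule (𝓞 K) K)) →ₗ[𝓞 K] ↥(dsum A B) where
  toFun := fun v => (⟨emb v.1 v.2, emb_mem_dsum.2 ⟨v.1.2, v.2.2⟩⟩ : dsum A B)
  map_add' v w := Subtype.ext (emb_add (v.1 : K) v.2 w.1 w.2).symm
  map_smul' r v := Subtype.ext (emb_smul r (v.1 : K) v.2).symm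

/-- `𝔞 ⊕ 𝔟` as an abstract module. -/
noncomputable def dsumEquiv (A B : FractionalIdeal (𝓞 K)⁰ K) :
    (↥(A : Submodule (𝓞 K) K) × ↥(B : Submodule (𝓞 K) K)) ≃ₗ[𝓞 K] ↥(dsum A B) :=
  LinearEquiv.ofBijective (dsumMap A B)
    ⟨fun v w h => by
      obtain ⟨h1, h2⟩ := emb_inj.1 (congrArg Subtype.val h)
      exact Prod.ext (Subtype.ext h1) (Subtype.ext h2),
    fun ⟨v, x, hx, y, hy, h⟩ => ⟨(⟨x, hx⟩, ⟨y, hy⟩), Subtype.ext h.symm⟩⟩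

theorem mulRight_dsum_le {A B A' B' : FractionalIdeal (𝓞 K)⁰ K}
    {γ : Matrix.GeneralLinearGroup (Fin 2) K}
    (h00 : ∀ x ∈ A, γ 0 0 * x ∈ A') (h01 : ∀ x ∈ A, γ 0 1 * x ∈ B')
    (h10 : ∀ y ∈ B, γ 1 0 * y ∈ A') (h11 : ∀ y ∈ B, γ 1 1 * y ∈ B') :
    mulRight (dsum A B) (toHat γ) ≤ dsum A' B' := by
  rintro _ ⟨_, ⟨x, hx, y, hy, rfl⟩, rfl⟩
  change Matrix.vecMul (emb x y) (toHat γ).val ∈ _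
  rw [emb_vecMul, emb_mem_dsum, mul_comm x, mul_comm x, mul_comm y, mul_comm y]
  exact ⟨(A' : Submodule (𝓞 K) K).add_mem (h00 x hx) (h10 y hy),
    (B' : Submodule (𝓞 K) K).add_mem (h01 x hx) (h11 y hy)⟩

theorem mulRight_eq_of_le {L M : Submodule (𝓞 K) (Row K)} {U : G K} (h : mulRight L U ≤ M)
    (h' : mulRight M U⁻¹ ≤ L) : mulRight L U = M := by
  refine le_antisymm h ?_
  have := mulRight_mono h' U
  rwa [← mulRight_mul, inv_mul_cancel, mulRight_one] at this

/-- The images of `(x, 0)` and `(0, y)`, with `x` and `y` nonzero, lie in `K²`, and dividing by `x`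
and `y` shows that the rows of `U` do too. -/
theorem exists_toHat_eq {A B A' B' : FractionalIdeal (𝓞 K)⁰ K} (hA : A ≠ 0) (hB : B ≠ 0)
    {U : G K} (h : mulRight (dsum A B) U ≤ dsum A' B') :
    ∃ γ : Matrix.GeneralLinearGroup (Fin 2) K, toHat γ = U := by
  obtain ⟨x, hx, hx0⟩ := exists_ne_zero_mem hA
  obtain ⟨y, hy, hy0⟩ := exists_ne_zero_mem hB
  obtain ⟨a, -, b, -, hab⟩ := h (vecMul_mem_mulRight
    (emb_mem_dsum.2 ⟨hx, (B : Submodule (𝓞 K) K).zero_mem⟩))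
  obtain ⟨c, -, d, -, hcd⟩ := h (vecMul_mem_mulRight
    (emb_mem_dsum.2 ⟨(A : Submodule (𝓞 K) K).zero_mem, hy⟩))
  have e0 := congrFun hab 0
  have e1 := congrFun hab 1
  have e2 := congrFun hcd 0
  have e3 := congrFun hcd 1
  simp only [Matrix.vecMul, dotProduct, Fin.sum_univ_two, Matrix.cons_val_zero,
    Matrix.cons_val_one, Matrix.cons_val_fin_one, map_zero, zero_mul, add_zero, zero_add]
    at e0 e1 e2 e3
  have f : ∀ {z w : K} {u : Khat K}, z ≠ 0 → algebraMap K (Khat K) z * u = algebraMap K _ w →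
      algebraMap K (Khat K) (z⁻¹ * w) = u := by
    intro z w u hz hu
    rw [map_mul, ← hu, ← mul_assoc, ← map_mul, inv_mul_cancel₀ hz, map_one, one_mul]
  set M : Matrix (Fin 2) (Fin 2) K := !![x⁻¹ * a, x⁻¹ * b; y⁻¹ * c, y⁻¹ * d] with hM
  have hMU : M.map (algebraMap K (Khat K)) = U.val := by
    ext i j
    fin_cases i <;> fin_cases j
    · exact f hx0 e0
    · exact f hx0 e1
    · exact f hy0 e2
    · exact f hy0 e3
  have hdet : M.det ≠ 0 := by
    intro h0
    have h1 : U.val.det = 0 := by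
      rw [← hMU, ← RingHom.mapMatrix_apply, ← RingHom.map_det, h0, map_zero]
    have h2 : IsUnit U.val.det := (Matrix.isUnit_iff_isUnit_det _).1 U.isUnit
    rw [h1] at h2
    exact not_isUnit_zero h2
  refine ⟨Matrix.GeneralLinearGroup.mkOfDetNeZero M hdet, Units.ext hMU⟩

theorem entry_mem_of_mulRight_dsum_le {A B A' B' : FractionalIdeal (𝓞 K)⁰ K}
    {γ : Matrix.GeneralLinearGroup (Fin 2) K} (h : mulRight (dsum A B) (toHat γ) ≤ dsum A' B') :
    (∀ x ∈ A, γ 0 0 * x ∈ A') ∧ (∀ x ∈ A, γ 0 1 * x ∈ B') ∧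
    (∀ y ∈ B, γ 1 0 * y ∈ A') ∧ (∀ y ∈ B, γ 1 1 * y ∈ B') := by
  have h1 : ∀ x ∈ A, γ 0 0 * x ∈ A' ∧ γ 0 1 * x ∈ B' := by
    intro x hx
    have := h (vecMul_mem_mulRight (emb_mem_dsum.2 ⟨hx, (B : Submodule (𝓞 K) K).zero_mem⟩))
    rw [emb_vecMul, emb_mem_dsum] at this
    simpa [mul_comm x] using this
  have h2 : ∀ y ∈ B, γ 1 0 * y ∈ A' ∧ γ 1 1 * y ∈ B' := by
    intro y hy
    have := h (vecMul_mem_mulRight (emb_mem_dsum.2 ⟨(A : Submodule (𝓞 K) K).zero_mem, hy⟩))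
    rw [emb_vecMul, emb_mem_dsum] at this
    simpa [mul_comm y] using this
  exact ⟨fun x hx => (h1 x hx).1, fun x hx => (h1 x hx).2, fun y hy => (h2 y hy).1,
    fun y hy => (h2 y hy).2⟩

/-- The matrix `(t α; -s β)` of determinant `α s + β t = 1`. -/
noncomputable def unimodular (α β s t : K) (h : α * s + β * t = 1) : Matrix.GeneralLinearGroup (Fin 2) K :=
  ⟨!![t, α; -s, β], !![β, -α; s, t],
    by ext i j; fin_cases i <;> fin_cases j <;> simp <;> first | linear_combination h | ring,
    by ext i j; fin_cases i <;> fin_cases j <;> simp <;> first | linear_combination h | ring⟩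

/-- The matrix and its inverse both have entries in the ideals that make the two inclusions hold. -/
theorem mulRight_dsum_unimodular {I₁ I₂ J : FractionalIdeal (𝓞 K)⁰ K} (h₁ : I₁ ≠ 0)
    (h₂ : I₂ ≠ 0) (hJ : J ≠ 0) {α β s t : K} (hα : α ∈ J * I₁⁻¹) (hβ : β ∈ J * I₂⁻¹)
    (hs : s ∈ I₁ * J⁻¹) (ht : t ∈ I₂ * J⁻¹) (h : α * s + β * t = 1) :
    mulRight (dsum I₁ I₂) (toHat (unimodular α β s t h)) = dsum (I₁ * I₂ * J⁻¹) J := by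
  have key : ∀ {A B C : FractionalIdeal (𝓞 K)⁰ K} {c x : K}, c ∈ A → x ∈ B → A * B = C →
      c * x ∈ C := by
    rintro A B _ c x hc hx rfl
    exact FractionalIdeal.mul_mem_mul hc hx
  have hneg : ∀ {A : FractionalIdeal (𝓞 K)⁰ K} {c : K}, c ∈ A → -c ∈ A := fun {A c} hc =>
    (A : Submodule (𝓞 K) K).neg_mem hc
  apply mulRight_eq_of_le
  · apply mulRight_dsum_le
    · exact fun x hx => key ht hx (by ring)
    · exact fun x hx => key hα hx (by rw [mul_assoc, inv_mul_cancel₀ h₁, mul_one])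
    · exact fun x hx => key (hneg hs) hx (by ring)
    · exact fun x hx => key hβ hx (by rw [mul_assoc, inv_mul_cancel₀ h₂, mul_one])
  · rw [← map_inv]
    apply mulRight_dsum_le
    · exact fun x hx => key hβ hx (by field_simp)
    · exact fun x hx => key (hneg hα) hx (by field_simp)
    · exact fun x hx => key hs hx (by rw [mul_assoc, inv_mul_cancel₀ hJ, mul_one])
    · exact fun x hx => key ht hx (by rw [mul_assoc, inv_mul_cancel₀ hJ, mul_one])

end Action

/-! ### Cyclic quotients described by generators. -/

section CyclicQuotient

variable {R M : Type*} [CommRing R] [AddCommGroup M] [Module R M]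

/-- With its converse `nonempty_quotient_equiv`, this encodes `L'/L ≅ R/n` by a vector `w`
generating `L'` modulo `L` with annihilator `n`. Such data transport along matrices without handling
quotient modules. -/
theorem exists_generator_of_quotient_equiv {L L' : Submodule R M} {n : Ideal R}
    (e : (L' ⧸ L.submoduleOf L') ≃ₗ[R] (R ⧸ n)) :
    ∃ w ∈ L', (∀ v ∈ L', ∃ r : R, v - r • w ∈ L) ∧ ∀ r : R, r • w ∈ L ↔ r ∈ n := by
  obtain ⟨w, hw⟩ := Submodule.Quotient.mk_surjective _ (e.symm (Submodule.Quotient.mk 1))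
  refine ⟨w, w.2, fun v hv => ?_, fun r => ?_⟩
  · obtain ⟨r, hr⟩ := Submodule.Quotient.mk_surjective _ (e (Submodule.Quotient.mk ⟨v, hv⟩))
    refine ⟨r, ?_⟩
    have h : (Submodule.Quotient.mk ⟨v, hv⟩ : L' ⧸ L.submoduleOf L') =
        Submodule.Quotient.mk (r • w) := by
      rw [Submodule.Quotient.mk_smul, hw, ← map_smul, ← Submodule.Quotient.mk_smul, smul_eq_mul,
        mul_one, hr, e.symm_apply_apply]
    exact (Submodule.Quotient.eq (L.submoduleOf L')).1 h
  · have h : (Submodule.Quotient.mk (r • w) : L' ⧸ L.submoduleOf L') = 0 ↔ r ∈ n := by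
      rw [Submodule.Quotient.mk_smul, hw, ← map_smul, ← Submodule.Quotient.mk_smul, smul_eq_mul,
        mul_one, LinearEquiv.map_eq_zero_iff, Submodule.Quotient.mk_eq_zero]
    rw [← h, Submodule.Quotient.mk_eq_zero]
    rfl

theorem nonempty_quotient_equiv {L L' : Submodule R M} {n : Ideal R} {w : M} (hw : w ∈ L')
    (hgen : ∀ v ∈ L', ∃ r : R, v - r • w ∈ L) (hann : ∀ r : R, r • w ∈ L ↔ r ∈ n) :
    Nonempty ((L' ⧸ L.submoduleOf L') ≃ₗ[R] (R ⧸ n)) := by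
  set φ : R →ₗ[R] (L' ⧸ L.submoduleOf L') :=
    (L.submoduleOf L').mkQ ∘ₗ LinearMap.toSpanSingleton R L' ⟨w, hw⟩ with hφ
  have hsurj : Function.Surjective φ := by
    intro v
    obtain ⟨⟨v, hv⟩, rfl⟩ := Submodule.Quotient.mk_surjective _ v
    obtain ⟨r, hr⟩ := hgen v hv
    exact ⟨r, ((Submodule.Quotient.eq (L.submoduleOf L')).2 hr).symm⟩
  have hker : LinearMap.ker φ = n := by
    ext r
    rw [← hann, LinearMap.mem_ker]
    exact Submodule.Quotient.mk_eq_zero (L.submoduleOf L')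
  exact ⟨((Submodule.quotEquivOfEq _ _ hker).symm.trans
    (φ.quotKerEquivOfSurjective hsurj)).symm⟩

end CyclicQuotient

/-! ### Classes of sums of ideals, and elementary divisors for a cyclic quotient. -/

section Classes

open FractionalIdeal

variable {K : Type*} [Field K] [NumberField K]

theorem NzIdeal.frac_mul_le (𝔞 : NzIdeal K) (B : FractionalIdeal (𝓞 K)⁰ K) : 𝔞.frac * B ≤ B := by
  calc 𝔞.frac * B ≤ 1 * B := by gcongr; exact FractionalIdeal.coeIdeal_le_one
    _ = B := one_mul B

/-- An integral ideal is isomorphic to its image in the field of fractions. -/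
noncomputable def coeIdealEquiv (I : Ideal (𝓞 K)) :
    I ≃ₗ[𝓞 K] ↥((I : FractionalIdeal (𝓞 K)⁰ K) : Submodule (𝓞 K) K) :=
  Submodule.equivMapOfInjective (Algebra.linearMap (𝓞 K) K)
    (FaithfulSMul.algebraMap_injective (𝓞 K) K) I

/-- `𝓞_K` is isomorphic to the unit fractional ideal. -/
noncomputable def coeOneEquiv :
    𝓞 K ≃ₗ[𝓞 K] ↥((1 : FractionalIdeal (𝓞 K)⁰ K) : Submodule (𝓞 K) K) :=
  Submodule.topEquiv.symm.trans ((coeIdealEquiv (⊤ : Ideal (𝓞 K))).trans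
    (LinearEquiv.ofEq _ _ (by rw [coeIdeal_top])))

/-- Multiplication by a nonzero element is an isomorphism of fractional ideals. -/
noncomputable def spanSingletonMulEquiv {x : K} (hx : x ≠ 0) (A : FractionalIdeal (𝓞 K)⁰ K) :
    ↥(A : Submodule (𝓞 K) K) ≃ₗ[𝓞 K]
      ↥((spanSingleton (𝓞 K)⁰ x * A : FractionalIdeal (𝓞 K)⁰ K) : Submodule (𝓞 K) K) :=
  (Submodule.equivMapOfInjective (LinearMap.mulLeft (𝓞 K) x)
    (mul_right_injective₀ hx) (A : Submodule (𝓞 K) K)).trans (LinearEquiv.ofEq _ _ (by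
      ext y
      rw [FractionalIdeal.mem_coe, mem_singleton_mul]
      constructor
      · rintro ⟨z, hz, rfl⟩; exact ⟨z, hz, rfl⟩
      · rintro ⟨z, hz, rfl⟩; exact ⟨z, hz, rfl⟩))

theorem exists_mulRight_dsum_eq {I₁ I₂ J : FractionalIdeal (𝓞 K)⁰ K} (h₁ : I₁ ≠ 0)
    (h₂ : I₂ ≠ 0) (hJ : J ≠ 0) : ∃ γ : Matrix.GeneralLinearGroup (Fin 2) K,
      mulRight (dsum I₁ I₂) (toHat γ) = dsum (I₁ * I₂ * J⁻¹) J := by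
  -- With `n = ⊤` there is no congruence to respect and surjectivity modulo `n` is vacuous, so zero
  -- multipliers can be the starting point.
  obtain ⟨α, hα, β, hβ, -, -, s, hs, t, ht, h⟩ := exists_unimodular (n := (⊤ : Ideal (𝓞 K)))
    top_ne_bot h₁ h₂ hJ (α := 0) (β := 0) (Submodule.zero_mem _) (Submodule.zero_mem _)
    (fun z hz => ⟨0, Submodule.zero_mem _, 0, Submodule.zero_mem _, by simpa using hz⟩)
  exact ⟨_, mulRight_dsum_unimodular h₁ h₂ hJ hα hβ hs ht h⟩

/-- One direction is the determinant invariance of the product of ideals; the other moves `A ⊕ B` to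
`AB ⊕ 1`. The matrix `U` plays no role, since `LU ≅ L`. -/
theorem hasClass_mulRight_dsum_iff {A B : FractionalIdeal (𝓞 K)⁰ K} (hA : A ≠ 0) (hB : B ≠ 0)
    {U : G K} {c : ClassGroup (𝓞 K)} :
    HasClass (mulRight (dsum A B) U) c ↔ ∃ 𝔞 : NzIdeal K, ClassGroup.mk0 𝔞 = c ∧
      ∃ x : K, x ≠ 0 ∧ spanSingleton (𝓞 K)⁰ x * 𝔞.frac = A * B := by
  constructor
  · rintro ⟨𝔞, h𝔞, ⟨e⟩⟩
    refine ⟨𝔞, h𝔞, ?_⟩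
    have e' := (coeOneEquiv.prodCongr (coeIdealEquiv (𝔞 : Ideal (𝓞 K)))).symm.trans
      (e.symm.trans ((mulRightEquiv (dsum A B) U).symm.trans (dsumEquiv A B).symm))
    simpa [NzIdeal.frac] using exists_mul_eq_of_linearEquiv
      (one_ne_zero (α := FractionalIdeal (𝓞 K)⁰ K)) 𝔞.frac_ne_zero e'
  · rintro ⟨𝔞, h𝔞, x, hx, h⟩
    refine ⟨𝔞, h𝔞, ?_⟩
    obtain ⟨γ, hγ⟩ := exists_mulRight_dsum_eq hA hB (one_ne_zero (α := FractionalIdeal (𝓞 K)⁰ K))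
    rw [inv_one, mul_one, ← h] at hγ
    exact ⟨(mulRightEquiv (dsum A B) U).symm.trans ((mulRightEquiv (dsum A B) (toHat γ)).trans
      ((LinearEquiv.ofEq _ _ hγ).trans ((dsumEquiv _ _).symm.trans
        ((LinearEquiv.prodComm _ _ _).trans (coeOneEquiv.prodCongr
          ((coeIdealEquiv (𝔞 : Ideal (𝓞 K))).trans (spanSingletonMulEquiv hx _))).symm))))⟩

theorem hasClass_unique {A B : FractionalIdeal (𝓞 K)⁰ K} (hA : A ≠ 0) (hB : B ≠ 0)
    {U : G K} {c c' : ClassGroup (𝓞 K)} (h : HasClass (mulRight (dsum A B) U) c)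
    (h' : HasClass (mulRight (dsum A B) U) c') : c = c' := by
  obtain ⟨𝔞, rfl, x, hx, hxa⟩ := (hasClass_mulRight_dsum_iff hA hB).1 h
  obtain ⟨𝔟, rfl, y, hy, hyb⟩ := (hasClass_mulRight_dsum_iff hA hB).1 h'
  rw [ClassGroup.mk0_eq_mk0_iff_exists_fraction_ring K]
  refine ⟨y⁻¹ * x, mul_ne_zero (inv_ne_zero hy) hx, ?_⟩
  change _ * 𝔞.frac = 𝔟.frac
  rw [← spanSingleton_mul_spanSingleton, mul_assoc, hxa, ← hyb, ← mul_assoc,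
    spanSingleton_mul_spanSingleton, inv_mul_cancel₀ hy, spanSingleton_one, one_mul]

theorem exists_hasClass {A B : FractionalIdeal (𝓞 K)⁰ K} (hA : A ≠ 0) (hB : B ≠ 0) (U : G K) :
    ∃ c, HasClass (mulRight (dsum A B) U) c := by
  obtain ⟨a, I, ha, hI⟩ := exists_eq_spanSingleton_mul (A * B)
  have hI0 : I ≠ 0 := by
    rintro rfl
    exact mul_ne_zero hA hB (by simpa using hI)
  exact ⟨ClassGroup.mk0 ⟨I, mem_nonZeroDivisors_of_ne_zero hI0⟩,
    (hasClass_mulRight_dsum_iff hA hB).2 ⟨_, rfl, _, inv_ne_zero (by simpa using ha), hI.symm⟩⟩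

/-- `J/𝔫J` is cyclic because `J = 𝔫J + (w)` for some `w`. If `rw ∈ 𝔫J` then `rJ ⊆ 𝔫J`, and
cancelling `J` gives `r ∈ 𝔫`. -/
theorem exists_generator_mod (𝔫 : NzIdeal K) {J : FractionalIdeal (𝓞 K)⁰ K} (hJ : J ≠ 0) :
    ∃ w ∈ J, (∀ v ∈ J, ∃ r : 𝓞 K, v - r • w ∈ 𝔫.frac * J) ∧
      ∀ r : 𝓞 K, r • w ∈ 𝔫.frac * J ↔ r ∈ (𝔫 : Ideal (𝓞 K)) := by
  obtain ⟨w, hw⟩ := IsDedekindDomain.exists_add_spanSingleton_mul_eq (𝔫.frac_mul_le J)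
    (mul_ne_zero 𝔫.frac_ne_zero hJ) (one_ne_zero (α := FractionalIdeal (𝓞 K)⁰ K))
  rw [mul_one, ← FractionalIdeal.sup_eq_add] at hw
  have hwJ : w ∈ J := by
    rw [← spanSingleton_le_iff_mem, ← hw]
    exact le_sup_right
  refine ⟨w, hwJ, fun v hv => ?_, fun r => ⟨fun hr => ?_, fun hr => ?_⟩⟩
  · rw [← hw, ← FractionalIdeal.mem_coe, FractionalIdeal.coe_sup, Submodule.mem_sup] at hv
    obtain ⟨y, hy, z, hz, rfl⟩ := hv
    obtain ⟨r, rfl⟩ := (mem_spanSingleton _).1 hz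
    exact ⟨r, by rw [add_sub_cancel_right]; exact hy⟩
  · have h1 : spanSingleton (𝓞 K)⁰ (algebraMap (𝓞 K) K r) * J ≤ 𝔫.frac * J := by
      conv_lhs => rw [← hw, FractionalIdeal.sup_eq_add, mul_add,
        spanSingleton_mul_spanSingleton, ← Algebra.smul_def]
      rw [← FractionalIdeal.sup_eq_add]
      refine sup_le ?_ (spanSingleton_le_iff_mem.2 hr)
      calc _ ≤ 1 * (𝔫.frac * J) := by
            gcongr
            rw [spanSingleton_le_iff_mem]
            exact coe_mem_one _ r
        _ = 𝔫.frac * J := one_mul _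
    have h2 := mul_le_mul_left h1 J⁻¹
    rw [mul_assoc, mul_assoc, mul_inv_cancel₀ hJ, mul_one, mul_one, spanSingleton_le_iff_mem,
      NzIdeal.frac, mem_coeIdeal] at h2
    obtain ⟨r', hr', h3⟩ := h2
    rwa [← FaithfulSMul.algebraMap_injective (𝓞 K) K h3]
  · rw [Algebra.smul_def]
    exact FractionalIdeal.mul_mem_mul (mem_coeIdeal_of_mem _ hr) hwJ

theorem projective_fractionalIdeal (A : FractionalIdeal (𝓞 K)⁰ K) :
    Module.Projective (𝓞 K) (A : Submodule (𝓞 K) K) := by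
  by_cases hA : A = 0
  · subst hA
    have : Subsingleton ((0 : FractionalIdeal (𝓞 K)⁰ K) : Submodule (𝓞 K) K) :=
      ⟨fun x y => Subtype.ext (((FractionalIdeal.mem_zero_iff _).1 x.2).trans
        ((FractionalIdeal.mem_zero_iff _).1 y.2).symm)⟩
    infer_instance
  · apply Submodule.projective_of_isUnit
    exact (isUnit_iff_ne_zero.2 hA).map (FractionalIdeal.coeSubmoduleHom (𝓞 K)⁰ K)

/-- Elementary divisors for a sublattice with cyclic quotient, with a prescribed ideal `J`. -/
theorem exists_mulRight_pair_eq {I₁ I₂ J : FractionalIdeal (𝓞 K)⁰ K} (h₁ : I₁ ≠ 0) (h₂ : I₂ ≠ 0)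
    (hJ : J ≠ 0) (𝔫 : NzIdeal K) {L : Submodule (𝓞 K) (Row K)} (hL : L ≤ dsum I₁ I₂)
    (e₁ : (dsum I₁ I₂ ⧸ L.submoduleOf (dsum I₁ I₂)) ≃ₗ[𝓞 K] (𝓞 K ⧸ (𝔫 : Ideal (𝓞 K)))) :
    ∃ γ : Matrix.GeneralLinearGroup (Fin 2) K,
      mulRight (dsum I₁ I₂) (toHat γ) = dsum (I₁ * I₂ * J⁻¹) J ∧
      mulRight L (toHat γ) = dsum (I₁ * I₂ * J⁻¹) (𝔫.frac * J) := by
  obtain ⟨w, hw, hgen, hann⟩ := exists_generator_mod 𝔫 hJ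
  obtain ⟨e₂⟩ := nonempty_quotient_equiv (L := ((𝔫.frac * J : FractionalIdeal (𝓞 K)⁰ K) :
    Submodule (𝓞 K) K)) (L' := (J : Submodule (𝓞 K) K)) hw hgen hann
  have := projective_fractionalIdeal I₁
  have := projective_fractionalIdeal I₂
  -- Lift `I₁ ⊕ I₂ → (I₁ ⊕ I₂)/L ≅ J/𝔫J` to a functional with values in `J`.
  obtain ⟨f, hf⟩ := Module.projective_lifting_property
    (Submodule.mkQ (((𝔫.frac * J : FractionalIdeal (𝓞 K)⁰ K) :
      Submodule (𝓞 K) K).submoduleOf (J : Submodule (𝓞 K) K)))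
    ((e₁.trans e₂.symm).toLinearMap ∘ₗ (L.submoduleOf (dsum I₁ I₂)).mkQ ∘ₗ
      (dsumEquiv I₁ I₂).toLinearMap) (Submodule.mkQ_surjective _)
  have hf' : ∀ v, Submodule.Quotient.mk (f v) = (e₁.trans e₂.symm)
      (Submodule.Quotient.mk (dsumEquiv I₁ I₂ v)) := fun v => LinearMap.congr_fun hf v
  obtain ⟨α, β, hαβ⟩ : ∃ α β : K, ∀ v, (f v : K) = α * v.1 + β * v.2 := by
    obtain ⟨α, hα⟩ := exists_forall_eq_mul
      ((J : Submodule (𝓞 K) K).subtype ∘ₗ f ∘ₗ LinearMap.inl (𝓞 K) _ _)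
    obtain ⟨β, hβ⟩ := exists_forall_eq_mul
      ((J : Submodule (𝓞 K) K).subtype ∘ₗ f ∘ₗ LinearMap.inr (𝓞 K) _ _)
    refine ⟨α, β, fun v => ?_⟩
    have hv : f v = f (v.1, 0) + f (0, v.2) := by rw [← map_add]; simp
    rw [← hα, ← hβ, hv]
    simp
  have hker : ∀ x ∈ I₁, ∀ y ∈ I₂, emb x y ∈ L ↔ α * x + β * y ∈ 𝔫.frac * J := by
    intro x hx y hy
    have h1 : (Submodule.Quotient.mk (dsumEquiv I₁ I₂ (⟨x, hx⟩, ⟨y, hy⟩)) :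
        dsum I₁ I₂ ⧸ L.submoduleOf (dsum I₁ I₂)) = 0 ↔ emb x y ∈ L :=
      Submodule.Quotient.mk_eq_zero _
    rw [← h1, ← LinearEquiv.map_eq_zero_iff (e₁.trans e₂.symm), ← hf',
      Submodule.Quotient.mk_eq_zero]
    change (f _ : K) ∈ 𝔫.frac * J ↔ _
    rw [hαβ]
  have hα : α ∈ J * I₁⁻¹ := by
    rw [mem_mul_inv_iff h₁]
    intro x hx
    have h := hαβ (⟨x, hx⟩, 0)
    simp only [ZeroMemClass.coe_zero, mul_zero, add_zero] at h
    rw [← h]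
    exact Subtype.mem _
  have hβ : β ∈ J * I₂⁻¹ := by
    rw [mem_mul_inv_iff h₂]
    intro x hx
    have h := hαβ (0, ⟨x, hx⟩)
    simp only [ZeroMemClass.coe_zero, mul_zero, zero_add] at h
    rw [← h]
    exact Subtype.mem _
  obtain ⟨α', hα', β', hβ', hα'α, hβ'β, s, hs, t, ht, h⟩ := exists_unimodular
    (nonZeroDivisors.ne_zero 𝔫.2) h₁ h₂ hJ hα hβ (by
      intro z hz
      obtain ⟨u, hu⟩ := Submodule.Quotient.mk_surjective _
        ((e₁.trans e₂.symm).symm (Submodule.Quotient.mk ⟨z, hz⟩))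
      obtain ⟨v, rfl⟩ := (dsumEquiv I₁ I₂).surjective u
      refine ⟨v.1, v.1.2, v.2, v.2.2, ?_⟩
      rw [← hαβ]
      have h1 := hf' v
      rw [hu, LinearEquiv.apply_symm_apply] at h1
      exact (Submodule.Quotient.eq (((𝔫.frac * J : FractionalIdeal (𝓞 K)⁰ K) :
        Submodule (𝓞 K) K).submoduleOf (J : Submodule (𝓞 K) K))).1 h1.symm)
  -- Changing the multipliers modulo `𝔫` changes values only by elements of `𝔫J`, so the functional
  -- still cuts out `L`.
  have hker' : ∀ x ∈ I₁, ∀ y ∈ I₂, emb x y ∈ L ↔ α' * x + β' * y ∈ 𝔫.frac * J := by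
    intro x hx y hy
    rw [← mul_assoc] at hα'α hβ'β
    have h1 := (mem_mul_inv_iff h₁).1 hα'α x hx
    have h2 := (mem_mul_inv_iff h₂).1 hβ'β y hy
    have h3 : (α' - α) * x + (β' - β) * y ∈ 𝔫.frac * J :=
      ((𝔫.frac * J : FractionalIdeal (𝓞 K)⁰ K) : Submodule (𝓞 K) K).add_mem h1 h2
    rw [hker x hx y hy, show α' * x + β' * y = (α * x + β * y) +
      ((α' - α) * x + (β' - β) * y) by ring]
    exact (((𝔫.frac * J : FractionalIdeal (𝓞 K)⁰ K) :
      Submodule (𝓞 K) K).add_mem_iff_left h3).symm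
  have hbase := mulRight_dsum_unimodular h₁ h₂ hJ hα' hβ' hs ht h
  have hact : ∀ x y, Matrix.vecMul (emb x y) (toHat (unimodular α' β' s t h)).val =
      emb (t * x - s * y) (α' * x + β' * y) := by
    intro x y
    rw [emb_vecMul]
    congr 1 <;> simp [unimodular] <;> ring
  refine ⟨_, hbase, le_antisymm ?_ ?_⟩
  · rintro _ ⟨v, hv, rfl⟩
    obtain ⟨x, hx, y, hy, rfl⟩ := hL hv
    change Matrix.vecMul (emb x y) (toHat (unimodular α' β' s t h)).val ∈ _
    have h1 := vecMul_mem_mulRight (U := toHat (unimodular α' β' s t h)) (hL hv)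
    rw [hbase, hact, emb_mem_dsum] at h1
    rw [hact, emb_mem_dsum]
    exact ⟨h1.1, (hker' x hx y hy).1 hv⟩
  · rintro _ ⟨p, hp, q, hq, rfl⟩
    have h1 : emb p q ∈ mulRight (dsum I₁ I₂) (toHat (unimodular α' β' s t h)) := by
      rw [hbase, emb_mem_dsum]
      exact ⟨hp, 𝔫.frac_mul_le J hq⟩
    obtain ⟨_, ⟨x, hx, y, hy, rfl⟩, h2⟩ := h1
    change Matrix.vecMul (emb x y) (toHat (unimodular α' β' s t h)).val = emb p q at h2
    have h3 := h2
    rw [hact, emb_inj] at h3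
    change emb p q ∈ _
    rw [← h2]
    exact vecMul_mem_mulRight ((hker' x hx y hy).2 (by rw [h3.2]; exact hq))

end Classes

/-! ### Every lattice is a translate of a sum of two fractional ideals, and conversely. -/

section Lattices

open FractionalIdeal

variable {K : Type*} [Field K] [NumberField K]

/-- The `K`-linear map `(x, y) ↦ (x, y) U` from `K²` to `K̂²`. -/
noncomputable def embMul (U : G K) : K × K →ₗ[K] Row K where
  toFun v := Matrix.vecMul (emb v.1 v.2) U.val
  map_add' v w := by rw [Prod.fst_add, Prod.snd_add, ← emb_add, Matrix.add_vecMul]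
  map_smul' r v := by
    rw [RingHom.id_apply, ← Matrix.smul_vecMul]
    congr 1
    ext i
    fin_cases i <;> simp [TensorProduct.smul_tmul']

theorem embMul_injective (U : G K) : Function.Injective (embMul U) := by
  intro v w h
  have h1 := congrArg (fun v => Matrix.vecMul v (U⁻¹ : G K).val) h
  have h2 : emb v.1 v.2 = emb w.1 w.2 := by
    simpa [embMul, Matrix.vecMul_vecMul] using h1
  exact Prod.ext (emb_inj.1 h2).1 (emb_inj.1 h2).2

theorem span_mulRight_dsum {A B : FractionalIdeal (𝓞 K)⁰ K} (hA : A ≠ 0) (hB : B ≠ 0) (U : G K) :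
    Submodule.span (Khat K) (mulRight (dsum A B) U : Set (Row K)) = ⊤ := by
  obtain ⟨a, ha, ha0⟩ := exists_ne_zero_mem hA
  obtain ⟨b, hb, hb0⟩ := exists_ne_zero_mem hB
  rw [eq_top_iff]
  intro v _
  set w := Matrix.vecMul v (U⁻¹ : G K).val with hw
  have hv : v = (w 0 * algebraMap K (Khat K) a⁻¹) • Matrix.vecMul (emb a 0) U.val +
      (w 1 * algebraMap K (Khat K) b⁻¹) • Matrix.vecMul (emb 0 b) U.val := by
    rw [← Matrix.smul_vecMul, ← Matrix.smul_vecMul, ← Matrix.add_vecMul]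
    have h1 : (w 0 * algebraMap K (Khat K) a⁻¹) • emb a 0 +
      (w 1 * algebraMap K (Khat K) b⁻¹) • emb 0 b = w := by
      ext i
      fin_cases i
      · simp [mul_assoc, ha0, ← Algebra.TensorProduct.one_def]
      · simp [mul_assoc, hb0, ← Algebra.TensorProduct.one_def]
    rw [h1, hw, Matrix.vecMul_vecMul]
    simp
  rw [hv]
  refine Submodule.add_mem _ (Submodule.smul_mem _ _ (Submodule.subset_span ?_))
    (Submodule.smul_mem _ _ (Submodule.subset_span ?_))
  · exact vecMul_mem_mulRight (emb_mem_dsum.2 ⟨ha, Submodule.zero_mem _⟩)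
  · exact vecMul_mem_mulRight (emb_mem_dsum.2 ⟨Submodule.zero_mem _, hb⟩)

/-- A zero summand would make one coordinate vanish on the whole `K̂`-span after undoing `U`; the
vector `(1, 1)U` refutes this. -/
theorem ne_zero_of_span_mulRight_dsum {A B : FractionalIdeal (𝓞 K)⁰ K} {U : G K}
    (h : Submodule.span (Khat K) (mulRight (dsum A B) U : Set (Row K)) = ⊤) :
    A ≠ 0 ∧ B ≠ 0 := by
  have key : ∀ i : Fin 2, ¬ ∀ v ∈ dsum A B, v i = 0 := by
    intro i hi
    have hle : Submodule.span (Khat K) (mulRight (dsum A B) U : Set (Row K)) ≤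
        (LinearMap.ker (LinearMap.proj i : Row K →ₗ[Khat K] Khat K)).comap
          (Matrix.vecMulLinear (U⁻¹ : G K).val) := by
      rw [Submodule.span_le]
      intro v hv
      exact hi _ (mem_mulRight.1 hv)
    rw [h] at hle
    have h1 := hle (Submodule.mem_top (x := Matrix.vecMul (fun _ => 1) U.val))
    rw [Submodule.mem_comap, LinearMap.mem_ker] at h1
    simp [Matrix.vecMul_vecMul] at h1
  constructor
  · rintro rfl
    refine key 0 ?_
    rintro _ ⟨x, hx, y, hy, rfl⟩
    simp [(FractionalIdeal.mem_zero_iff _).1 hx]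
  · rintro rfl
    refine key 1 ?_
    rintro _ ⟨x, hx, y, hy, rfl⟩
    simp [(FractionalIdeal.mem_zero_iff _).1 hy]

theorem dsum_mono {A B A' B' : FractionalIdeal (𝓞 K)⁰ K} (hA : A ≤ A') (hB : B ≤ B') :
    dsum A B ≤ dsum A' B' := by
  rintro _ ⟨x, hx, y, hy, rfl⟩
  exact ⟨x, hA hx, y, hB hy, rfl⟩

theorem free_mulRight_dsum {x y : K} (hx : x ≠ 0) (hy : y ≠ 0) (U : G K) :
    Module.Free (𝓞 K) (mulRight (dsum (spanSingleton _ x * 1) (spanSingleton _ y * 1)) U) ∧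
    Module.finrank (𝓞 K)
      (mulRight (dsum (spanSingleton _ x * 1) (spanSingleton _ y * 1)) U) = 2 := by
  have e : (𝓞 K × 𝓞 K) ≃ₗ[𝓞 K]
      (mulRight (dsum (spanSingleton _ x * 1) (spanSingleton _ y * 1)) U) :=
    ((coeOneEquiv.trans (spanSingletonMulEquiv hx 1)).prodCongr
      (coeOneEquiv.trans (spanSingletonMulEquiv hy 1))).trans
        ((dsumEquiv _ _).trans (mulRightEquiv _ U))
  exact ⟨Module.Free.of_equiv e, by rw [← e.finrank_eq]; simp⟩

theorem isLattice_mulRight_dsum {A B : FractionalIdeal (𝓞 K)⁰ K} (hA : A ≠ 0) (hB : B ≠ 0)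
    (U : G K) : IsLattice (mulRight (dsum A B) U) := by
  have hlow : ∀ {C : FractionalIdeal (𝓞 K)⁰ K}, C ≠ 0 → ∃ x : K, x ≠ 0 ∧
      x ∈ C ∧ spanSingleton (𝓞 K)⁰ x * 1 ≤ C := by
    intro C hC
    obtain ⟨a, ha, ha0⟩ := exists_ne_zero_mem hC
    exact ⟨a, ha0, ha, by rwa [mul_one, spanSingleton_le_iff_mem]⟩
  have hup : ∀ C : FractionalIdeal (𝓞 K)⁰ K, ∃ x : K, x ≠ 0 ∧
      C ≤ spanSingleton (𝓞 K)⁰ x * 1 := by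
    intro C
    obtain ⟨a, I, ha, hI⟩ := exists_eq_spanSingleton_mul C
    refine ⟨(algebraMap (𝓞 K) K a)⁻¹, inv_ne_zero (by simpa using ha), ?_⟩
    rw [hI]
    gcongr
    exact coeIdeal_le_one
  obtain ⟨a, ha0, ha, haA⟩ := hlow hA
  obtain ⟨b, hb0, hb, hbB⟩ := hlow hB
  obtain ⟨a', ha'0, haA'⟩ := hup A
  obtain ⟨b', hb'0, hbB'⟩ := hup B
  refine ⟨span_mulRight_dsum hA hB U, ⟨_, _, free_mulRight_dsum ha0 hb0 U,
    free_mulRight_dsum ha'0 hb'0 U, mulRight_mono (dsum_mono haA hbB) U,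
    mulRight_mono (dsum_mono haA' hbB') U⟩, ?_, ?_⟩
  · rw [← Module.Finite.iff_fg]
    have h1 : Module.Finite (𝓞 K) (A : Submodule (𝓞 K) K) :=
      Module.Finite.iff_fg.2 (fg_of_isUnit A (isUnit_iff_ne_zero.2 hA))
    have h2 : Module.Finite (𝓞 K) (B : Submodule (𝓞 K) K) :=
      Module.Finite.iff_fg.2 (fg_of_isUnit B (isUnit_iff_ne_zero.2 hB))
    exact Module.Finite.equiv ((dsumEquiv A B).trans (mulRightEquiv _ U))
  · have hspan : Submodule.span K (mulRight (dsum A B) U : Set (Row K)) =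
        LinearMap.range (embMul U) := by
      apply le_antisymm
      · rw [Submodule.span_le]
        rintro _ ⟨_, ⟨x, hx, y, hy, rfl⟩, rfl⟩
        exact ⟨(x, y), rfl⟩
      · rintro _ ⟨⟨x, y⟩, rfl⟩
        have h1 : ((x, y) : K × K) = (x * a⁻¹) • (a, 0) + (y * b⁻¹) • (0, b) := by
          ext <;> simp [ha0, hb0]
        rw [h1, map_add, map_smul, map_smul]
        refine Submodule.add_mem _ (Submodule.smul_mem _ _ (Submodule.subset_span ?_))
          (Submodule.smul_mem _ _ (Submodule.subset_span ?_))
        · exact vecMul_mem_mulRight (emb_mem_dsum.2 ⟨ha, Submodule.zero_mem _⟩)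
        · exact vecMul_mem_mulRight (emb_mem_dsum.2 ⟨Submodule.zero_mem _, hb⟩)
    rw [hspan, LinearMap.finrank_range_of_inj (embMul_injective U)]
    simp

/-- The rows of `U` are a `K`-basis of `KL`. They span `K̂²` over `K̂` because `L` does, so the
square matrix is invertible. -/
theorem IsLattice.exists_forall_eq_embMul {L : Submodule (𝓞 K) (Row K)} (hL : IsLattice L) :
    ∃ U : G K, ∀ v ∈ L, ∃ w, embMul U w = v := by
  have hfin : Module.Finite K (Submodule.span K (L : Set (Row K))) :=
    Module.finite_of_finrank_pos (by rw [hL.finrank_span]; norm_num)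
  set b := Module.finBasisOfFinrankEq K _ hL.finrank_span with hb
  set V : Matrix (Fin 2) (Fin 2) (Khat K) := Matrix.of fun i => (b i : Row K) with hV
  have hrep : ∀ v ∈ L, ∃ x y : K, Matrix.vecMul (emb x y) V = v := by
    intro v hv
    have h1 := b.sum_repr ⟨v, Submodule.subset_span hv⟩
    rw [Fin.sum_univ_two] at h1
    have h2 := congrArg Subtype.val h1
    refine ⟨b.repr ⟨v, Submodule.subset_span hv⟩ 0, b.repr ⟨v, Submodule.subset_span hv⟩ 1,
      Eq.trans ?_ h2⟩
    ext i
    simp only [Matrix.vecMul, dotProduct, Fin.sum_univ_two, hV, Submodule.coe_add,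
      Submodule.coe_smul, Pi.add_apply, Algebra.smul_def]
    rfl
  have hunit : IsUnit V := by
    rw [← Matrix.vecMul_surjective_iff_isUnit]
    have h1 : LinearMap.range (Matrix.vecMulLinear V) = ⊤ := by
      rw [eq_top_iff, ← hL.span_eq_top, Submodule.span_le]
      intro v hv
      obtain ⟨x, y, h⟩ := hrep v hv
      exact ⟨_, h⟩
    exact LinearMap.range_eq_top.1 h1
  obtain ⟨U, hU⟩ := hunit
  refine ⟨U, fun v hv => ?_⟩
  obtain ⟨x, y, h⟩ := hrep v hv
  exact ⟨(x, y), by rw [← h, ← hU]; rfl⟩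

/-- A finitely generated submodule of `K²` is, up to a unipotent matrix, a sum of two fractional
ideals. -/
theorem exists_fractionalIdeals_of_fg {N : Submodule (𝓞 K) (K × K)} (hN : N.FG) :
    ∃ (I₁ I₂ : FractionalIdeal (𝓞 K)⁰ K) (t : K),
      ∀ x y, (x, y) ∈ N ↔ x ∈ I₁ ∧ y - t * x ∈ I₂ := by
  have h1 : (N.map (LinearMap.fst (𝓞 K) K K)).FG := hN.map _
  have h2 : (N.comap (LinearMap.inr (𝓞 K) K K)).FG := by
    have : Module.Finite (𝓞 K) N := Module.Finite.iff_fg.2 hN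
    have : IsNoetherian (𝓞 K) N := isNoetherian_of_isNoetherianRing_of_finite _ _
    refine Submodule.fg_of_fg_map_injective (LinearMap.inr (𝓞 K) K K) LinearMap.inr_injective ?_
    exact (isNoetherian_submodule.1 this) _ (Submodule.map_comap_le _ _)
  set I₁ : FractionalIdeal (𝓞 K)⁰ K := ⟨_, isFractional_of_fg h1⟩
  set I₂ : FractionalIdeal (𝓞 K)⁰ K := ⟨_, isFractional_of_fg h2⟩
  have hproj : Module.Projective (𝓞 K) (N.map (LinearMap.fst (𝓞 K) K K)) :=
    projective_fractionalIdeal I₁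
  -- A section of the first projection; its second coordinate is a functional on `I₁`, hence
  -- multiplication by some `t`.
  obtain ⟨σ, hσ⟩ := Module.projective_lifting_property
    ((LinearMap.fst (𝓞 K) K K).submoduleMap N) LinearMap.id
    ((LinearMap.fst (𝓞 K) K K).submoduleMap_surjective N)
  obtain ⟨t, ht⟩ := exists_forall_eq_mul (A := I₁)
    (LinearMap.snd (𝓞 K) K K ∘ₗ N.subtype ∘ₗ σ)
  have hmem : ∀ x ∈ I₁, (x, t * x) ∈ N := by
    intro x hx
    have e1 : ((σ ⟨x, hx⟩ : K × K)).1 = x :=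
      congrArg Subtype.val (LinearMap.congr_fun hσ ⟨x, hx⟩)
    have e2 : ((σ ⟨x, hx⟩ : K × K)).2 = t * x := ht ⟨x, hx⟩
    rw [← e2]
    nth_rewrite 1 [← e1]
    exact (σ ⟨x, hx⟩).2
  refine ⟨I₁, I₂, t, fun x y => ⟨fun h => ?_, fun h => ?_⟩⟩
  · have hx : x ∈ I₁ := ⟨(x, y), h, rfl⟩
    refine ⟨hx, ?_⟩
    have h3 := N.sub_mem h (hmem x hx)
    rw [Prod.mk_sub_mk, sub_self] at h3
    exact h3
  · have h4 : ((0 : K), y - t * x) ∈ N := h.2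
    have h3 := N.add_mem h4 (hmem x h.1)
    rwa [Prod.mk_add_mk, zero_add, sub_add_cancel] at h3

theorem IsLattice.exists_eq_mulRight_dsum {L : Submodule (𝓞 K) (Row K)} (hL : IsLattice L) :
    ∃ (I₁ I₂ : FractionalIdeal (𝓞 K)⁰ K) (U : G K), I₁ ≠ 0 ∧ I₂ ≠ 0 ∧
      L = mulRight (dsum I₁ I₂) U := by
  obtain ⟨U, hU⟩ := hL.exists_forall_eq_embMul
  set φ := (embMul U).restrictScalars (𝓞 K) with hφ
  have hmap : (L.comap φ).map φ = L := by
    apply Submodule.map_comap_eq_of_le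
    intro v hv
    exact hU v hv
  have hfg : (L.comap φ).FG := by
    apply Submodule.fg_of_fg_map_injective φ (embMul_injective U)
    rw [hmap]
    exact hL.fg
  obtain ⟨I₁, I₂, t, ht⟩ := exists_fractionalIdeals_of_fg hfg
  -- The parameters give the unipotent matrix `(1 t; 0 1)`, which undoes the shear.
  have hγ : (t : K) * 0 + 1 * 1 = 1 := by ring
  have hact : ∀ x y, Matrix.vecMul (emb x y) (toHat (unimodular t 1 0 1 hγ) * U).val =
      φ (x, t * x + y) := by
    intro x y
    rw [Units.val_mul, ← Matrix.vecMul_vecMul, emb_vecMul]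
    simp [hφ, embMul, unimodular, mul_comm]
  have heq : L = mulRight (dsum I₁ I₂) (toHat (unimodular t 1 0 1 hγ) * U) := by
    apply le_antisymm
    · intro v hv
      obtain ⟨⟨x, y⟩, rfl⟩ := hU v hv
      have h1 := (ht x y).1 hv
      have h2 := vecMul_mem_mulRight (U := toHat (unimodular t 1 0 1 hγ) * U)
        (emb_mem_dsum.2 h1)
      rw [hact, add_sub_cancel] at h2
      exact h2
    · rintro _ ⟨_, ⟨x, hx, y, hy, rfl⟩, rfl⟩
      change Matrix.vecMul (emb x y) (toHat (unimodular t 1 0 1 hγ) * U).val ∈ L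
      rw [hact]
      exact (ht x (t * x + y)).2 ⟨hx, by simpa using hy⟩
  obtain ⟨hI₁, hI₂⟩ := ne_zero_of_span_mulRight_dsum (heq ▸ hL.span_eq_top)
  exact ⟨I₁, I₂, _, hI₁, hI₂, heq⟩

end Lattices

/-! ### Modular points, the stabilizer of a standard point, and the indexing of classes. -/

section ModularPoints

open FractionalIdeal

variable {K : Type*} [Field K] [NumberField K]

theorem nonempty_quotient_mulRight_equiv {L L' : Submodule (𝓞 K) (Row K)} {n : Ideal (𝓞 K)} (U : G K)
    (h : Nonempty ((L' ⧸ L.submoduleOf L') ≃ₗ[𝓞 K] (𝓞 K ⧸ n))) :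
    Nonempty ((mulRight L' U ⧸ (mulRight L U).submoduleOf (mulRight L' U)) ≃ₗ[𝓞 K] (𝓞 K ⧸ n)) := by
  obtain ⟨e⟩ := h
  obtain ⟨w, hw, hgen, hann⟩ := exists_generator_of_quotient_equiv e
  have hmem : ∀ {v}, Matrix.vecMul v U.val ∈ mulRight L U ↔ v ∈ L := fun {v} => by
    rw [mem_mulRight, Matrix.vecMul_vecMul]
    simp
  refine nonempty_quotient_equiv (vecMul_mem_mulRight hw) ?_ fun r => ?_
  · rintro _ ⟨v, hv, rfl⟩
    obtain ⟨r, hr⟩ := hgen v hv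
    refine ⟨r, ?_⟩
    rw [← hmem, Matrix.sub_vecMul, Matrix.smul_vecMul] at hr
    exact hr
  · rw [← hann, ← hmem, Matrix.smul_vecMul]

theorem isModularPoint_pairMul_dsum {A J : FractionalIdeal (𝓞 K)⁰ K} (hA : A ≠ 0) (hJ : J ≠ 0)
    (𝔫 : NzIdeal K) (U : G K) :
    IsModularPoint 𝔫 (pairMul (dsum A (𝔫.frac * J), dsum A J) U) where
  lattice_fst := isLattice_mulRight_dsum hA (mul_ne_zero 𝔫.frac_ne_zero hJ) U
  lattice_snd := isLattice_mulRight_dsum hA hJ U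
  le := mulRight_mono (dsum_mono le_rfl (𝔫.frac_mul_le J)) U
  quot := by
    apply nonempty_quotient_mulRight_equiv
    obtain ⟨w, hw, hgen, hann⟩ := exists_generator_mod 𝔫 hJ
    refine nonempty_quotient_equiv (w := emb 0 w)
      (emb_mem_dsum.2 ⟨Submodule.zero_mem _, hw⟩) ?_ fun r => ?_
    · rintro _ ⟨x, hx, y, hy, rfl⟩
      obtain ⟨r, hr⟩ := hgen y hy
      refine ⟨r, x, hx, y - r • w, hr, ?_⟩
      rw [emb_smul, sub_eq_iff_eq_add]
      change emb x y = emb _ _ + emb _ _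
      rw [emb_add]
      simp
    · rw [emb_smul, emb_mem_dsum, hann, smul_zero]
      exact and_iff_right (Submodule.zero_mem _)

/-- Straighten the larger lattice to a sum of ideals, then apply elementary divisors to the smaller
one. The freedom in `J` is what later allows matching `P_{ij}`. -/
theorem IsModularPoint.exists_eq_pairMul_dsum {𝔫 : NzIdeal K}
    {P : Submodule (𝓞 K) (Row K) × Submodule (𝓞 K) (Row K)} (hP : IsModularPoint 𝔫 P)
    {J : FractionalIdeal (𝓞 K)⁰ K} (hJ : J ≠ 0) :
    ∃ (A : FractionalIdeal (𝓞 K)⁰ K) (U : G K), A ≠ 0 ∧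
      P = pairMul (dsum A (𝔫.frac * J), dsum A J) U := by
  obtain ⟨I₁, I₂, V, h₁, h₂, hV⟩ := hP.lattice_snd.exists_eq_mulRight_dsum
  have hinv := mulRight_inv_eq hV.symm
  have hle := mulRight_mono hP.le V⁻¹
  obtain ⟨e⟩ := nonempty_quotient_mulRight_equiv V⁻¹ hP.quot
  rw [hinv] at hle e
  obtain ⟨γ, h, h'⟩ := exists_mulRight_pair_eq h₁ h₂ hJ 𝔫 hle e
  refine ⟨I₁ * I₂ * J⁻¹, (toHat γ)⁻¹ * V, mul_ne_zero (mul_ne_zero h₁ h₂) (inv_ne_zero hJ), ?_⟩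
  rw [← h', ← h]
  refine Prod.ext ?_ ?_
  · simp [pairMul, ← mulRight_mul]
  · simp [pairMul, ← mulRight_mul, hV]

theorem mulRight_dsum_diagonal {z : K} (hz : z ≠ 0) :
    ∃ γ : Matrix.GeneralLinearGroup (Fin 2) K, ∀ A B : FractionalIdeal (𝓞 K)⁰ K,
      mulRight (dsum A B) (toHat γ) = dsum (spanSingleton _ z * A) B := by
  have hdet : (!![z, 0; 0, 1] : Matrix (Fin 2) (Fin 2) K).det ≠ 0 := by simpa using hz
  set γ := Matrix.GeneralLinearGroup.mkOfDetNeZero _ hdet with hγ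
  have hact : ∀ x y, Matrix.vecMul (emb x y) (toHat γ).val = emb (z * x) y := by
    intro x y
    rw [emb_vecMul]
    congr 1 <;> simp [hγ, Matrix.GeneralLinearGroup.mkOfDetNeZero, mul_comm]
  refine ⟨γ, fun A B => le_antisymm ?_ ?_⟩
  · rintro _ ⟨_, ⟨x, hx, y, hy, rfl⟩, rfl⟩
    change Matrix.vecMul (emb x y) (toHat γ).val ∈ _
    rw [hact, emb_mem_dsum]
    exact ⟨mem_singleton_mul.2 ⟨x, hx, rfl⟩, hy⟩
  · rintro _ ⟨_, hzx, y, hy, rfl⟩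
    obtain ⟨x, hx, rfl⟩ := mem_singleton_mul.1 hzx
    exact ⟨emb x y, emb_mem_dsum.2 ⟨hx, hy⟩, hact x y⟩

/-- Each entry condition is an inclusion of ideals. The lattice `A ⊕ B` forces the upper right entry
into `BA⁻¹ = 𝔭⁻¹`, and `A ⊕ B𝔫⁻¹` forces the lower left one into `AB⁻¹𝔫 = 𝔫𝔭`. -/
theorem mem_Γ₀_iff_pairMul_eq {A B : FractionalIdeal (𝓞 K)⁰ K} (hA : A ≠ 0) (hB : B ≠ 0)
    {𝔭 𝔫 : NzIdeal K} (hAB : A = 𝔭.frac * B) {γ : Matrix.GeneralLinearGroup (Fin 2) K} :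
    γ ∈ Γ₀ 𝔭 𝔫 ↔ pairMul (dsum A B, dsum A (B * 𝔫.frac⁻¹)) (toHat γ) =
      (dsum A B, dsum A (B * 𝔫.frac⁻¹)) := by
  have h𝔭 := 𝔭.frac_ne_zero
  have h𝔫 := 𝔫.frac_ne_zero
  have hB' : B * 𝔫.frac⁻¹ ≠ 0 := mul_ne_zero hB (inv_ne_zero h𝔫)
  have half : ∀ {δ : Matrix.GeneralLinearGroup (Fin 2) K}, δ ∈ Γ₀ 𝔭 𝔫 →
      mulRight (dsum A B) (toHat δ) ≤ dsum A B ∧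
      mulRight (dsum A (B * 𝔫.frac⁻¹)) (toHat δ) ≤ dsum A (B * 𝔫.frac⁻¹) := by
    rintro δ ⟨h00, h11, h01, h10, -⟩
    have key : ∀ {C D E : FractionalIdeal (𝓞 K)⁰ K} {c x : K}, c ∈ C → x ∈ D → C * D ≤ E →
        c * x ∈ E := fun hc hx h => h (FractionalIdeal.mul_mem_mul hc hx)
    have hinv : 1 ≤ 𝔫.frac⁻¹ := by
      have := mul_le_mul_left (show 𝔫.frac ≤ 1 from coeIdeal_le_one) 𝔫.frac⁻¹
      rwa [mul_inv_cancel₀ h𝔫, one_mul] at this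
    constructor <;> apply mulRight_dsum_le
    · exact fun x hx => key h00 hx (one_mul A).le
    · exact fun x hx => key h01 hx (by rw [hAB, inv_mul_cancel_left₀ h𝔭])
    · refine fun x hx => key h10 hx ?_
      rw [hAB, mul_assoc]
      exact 𝔫.frac_mul_le _
    · exact fun x hx => key h11 hx (one_mul B).le
    · exact fun x hx => key h00 hx (one_mul A).le
    · refine fun x hx => key h01 hx ?_
      rw [hAB, inv_mul_cancel_left₀ h𝔭]
      calc B = B * 1 := (mul_one B).symm
        _ ≤ B * 𝔫.frac⁻¹ := by gcongr
    · refine fun x hx => key h10 hx (le_of_eq ?_)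
      rw [hAB]
      field_simp
    · exact fun x hx => key h11 hx (one_mul _).le
  constructor
  · intro hγ
    have h1 := half hγ
    have h2 := half (inv_mem hγ)
    rw [map_inv] at h2
    exact Prod.ext (mulRight_eq_of_le h1.1 h2.1) (mulRight_eq_of_le h1.2 h2.2)
  · intro h
    have key : ∀ {δ : Matrix.GeneralLinearGroup (Fin 2) K},
        pairMul (dsum A B, dsum A (B * 𝔫.frac⁻¹)) (toHat δ) =
          (dsum A B, dsum A (B * 𝔫.frac⁻¹)) →
        δ 0 0 ∈ (1 : FractionalIdeal (𝓞 K)⁰ K) ∧ δ 1 1 ∈ (1 : FractionalIdeal (𝓞 K)⁰ K) ∧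
          δ 0 1 ∈ 𝔭.frac⁻¹ ∧ δ 1 0 ∈ 𝔫.frac * 𝔭.frac ∧
          (δ : Matrix (Fin 2) (Fin 2) K).det ∈ (1 : FractionalIdeal (𝓞 K)⁰ K) := by
      intro δ hδ
      obtain ⟨h00, h01, -, h11⟩ := entry_mem_of_mulRight_dsum_le (congrArg Prod.fst hδ).le
      obtain ⟨-, -, h10, -⟩ := entry_mem_of_mulRight_dsum_le (congrArg Prod.snd hδ).le
      rw [← mem_mul_inv_iff hA, mul_inv_cancel₀ hA] at h00
      rw [← mem_mul_inv_iff hB, mul_inv_cancel₀ hB] at h11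
      rw [← mem_mul_inv_iff hA, show B * A⁻¹ = 𝔭.frac⁻¹ by rw [hAB]; field_simp] at h01
      rw [← mem_mul_inv_iff hB', show A * (B * 𝔫.frac⁻¹)⁻¹ = 𝔫.frac * 𝔭.frac by
        rw [hAB]; field_simp] at h10
      refine ⟨h00, h11, h01, h10, ?_⟩
      rw [Matrix.det_fin_two]
      have m1 := FractionalIdeal.mul_mem_mul h00 h11
      have m2 := FractionalIdeal.mul_mem_mul h01 h10
      rw [mul_one] at m1
      rw [mul_comm 𝔫.frac, inv_mul_cancel_left₀ h𝔭] at m2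
      exact ((1 : FractionalIdeal (𝓞 K)⁰ K) : Submodule (𝓞 K) K).sub_mem m1
        ((show 𝔫.frac ≤ 1 from coeIdeal_le_one) m2)
    obtain ⟨h00, h11, h01, h10, hdet⟩ := key h
    have h' : pairMul (dsum A B, dsum A (B * 𝔫.frac⁻¹)) (toHat γ⁻¹) =
        (dsum A B, dsum A (B * 𝔫.frac⁻¹)) := by
      conv_lhs => rw [← h, ← pairMul_mul, ← map_mul, mul_inv_cancel, map_one, pairMul_one]
    -- The inverse stabilizes the pair too, so both determinants are integral with product one,
    -- hence units.
    obtain ⟨-, -, -, -, hdet'⟩ := key h'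
    obtain ⟨u, hu⟩ := (mem_one_iff _).1 hdet
    obtain ⟨v, hv⟩ := (mem_one_iff _).1 hdet'
    have huv : u * v = 1 := by
      apply FaithfulSMul.algebraMap_injective (𝓞 K) K
      rw [map_mul, hu, hv, ← Matrix.det_mul, ← Units.val_mul, mul_inv_cancel, map_one]
      simp
    refine ⟨h00, h11, h01, h10, Units.mkOfMulEqOne u v huv, ?_⟩
    rw [← Matrix.det_fin_two]
    exact hu.symm

namespace ClassReps

variable {ι κ : Type*} (R : ClassReps K ι κ)

/-- The coset of `c` modulo squares singles out `i`; then `c[𝔭_i]⁻¹` is a square and singles out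
`j`. -/
theorem existsUnique_c_eq (c : ClassGroup (𝓞 K)) : ∃! ij : ι × κ, R.c ij.1 ij.2 = c := by
  have hq : ∀ i j, (QuotientGroup.mk (R.c i j) : ClassGroup (𝓞 K) ⧸
      (powMonoidHom 2 : ClassGroup (𝓞 K) →* ClassGroup (𝓞 K)).range) =
        QuotientGroup.mk (ClassGroup.mk0 (R.𝔭 i)) := by
    intro i j
    rw [eq_comm, QuotientGroup.eq]
    exact ⟨ClassGroup.mk0 (R.𝔮 j), by simp [ClassReps.c]⟩
  obtain ⟨i, hi⟩ := R.𝔭_bijective.2 (QuotientGroup.mk c)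
  obtain ⟨d, hd⟩ := QuotientGroup.eq.1 hi
  obtain ⟨j, -, hj⟩ := R.𝔮_sq_bijOn.surjOn
    (show IsSquare (d ^ 2) from ⟨d, pow_two d⟩)
  have hij : R.c i j = c := by
    rw [ClassReps.c]
    dsimp only at hj
    rw [hj]
    change d ^ 2 = _ at hd
    rw [hd, mul_inv_cancel_left]
  refine ⟨(i, j), hij, ?_⟩
  rintro ⟨i', j'⟩ h
  dsimp only at h
  have hii : i' = i := by
    apply R.𝔭_bijective.1
    dsimp only
    rw [← hq i' j', ← hq i j, h, hij]
  subst hii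
  rw [← hij, ClassReps.c, ClassReps.c, mul_right_inj] at h
  rw [R.𝔮_sq_bijOn.injOn (Set.mem_univ j') (Set.mem_univ j) h]

theorem stdPoint_eq (𝔫 : NzIdeal K) (i : ι) (j : κ) : R.stdPoint 𝔫 i j =
    (dsum ((R.𝔭 i).frac * (R.𝔮 j).frac) (𝔫.frac * ((R.𝔮 j).frac * 𝔫.frac⁻¹)),
      dsum ((R.𝔭 i).frac * (R.𝔮 j).frac) ((R.𝔮 j).frac * 𝔫.frac⁻¹)) := by
  rw [stdPoint, mul_comm _ 𝔫.frac⁻¹, mul_inv_cancel_left₀ 𝔫.frac_ne_zero]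

theorem frac_mul_ne_zero (i : ι) (j : κ) : (R.𝔭 i).frac * (R.𝔮 j).frac ≠ 0 :=
  mul_ne_zero (R.𝔭 i).frac_ne_zero (R.𝔮 j).frac_ne_zero

theorem c_eq_mk0 (i : ι) (j : κ) : R.c i j = ClassGroup.mk0 (R.𝔭 i * R.𝔮 j * R.𝔮 j) := by
  rw [c, map_mul, map_mul, pow_two, mul_assoc]

theorem frac_mul (i : ι) (j : κ) : (R.𝔭 i * R.𝔮 j * R.𝔮 j : NzIdeal K).frac =
    (R.𝔭 i).frac * (R.𝔮 j).frac * (R.𝔮 j).frac := by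
  simp [NzIdeal.frac]

theorem pairMul_stdPoint_mem (𝔫 : NzIdeal K) (i : ι) (j : κ) (U : G K) :
    pairMul (R.stdPoint 𝔫 i j) U ∈ M₀Class 𝔫 (R.c i j) := by
  constructor
  · rw [stdPoint_eq]
    exact isModularPoint_pairMul_dsum (R.frac_mul_ne_zero i j)
      (mul_ne_zero (R.𝔮 j).frac_ne_zero (inv_ne_zero 𝔫.frac_ne_zero)) 𝔫 U
  · refine (hasClass_mulRight_dsum_iff (R.frac_mul_ne_zero i j) (R.𝔮 j).frac_ne_zero).2
      ⟨_, (R.c_eq_mk0 i j).symm, 1, one_ne_zero, ?_⟩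
    rw [spanSingleton_one, one_mul, frac_mul]

theorem exists_isAdmissible (𝔫 : NzIdeal K) (i : ι) (j : κ)
    {P : Submodule (𝓞 K) (Row K) × Submodule (𝓞 K) (Row K)} (hP : P ∈ M₀Class 𝔫 (R.c i j)) :
    ∃ U : G K, R.IsAdmissible 𝔫 i j P U := by
  have hq := (R.𝔮 j).frac_ne_zero
  obtain ⟨hP, hc⟩ := hP
  obtain ⟨A, U, hA, rfl⟩ := IsModularPoint.exists_eq_pairMul_dsum hP
    (mul_ne_zero hq (inv_ne_zero 𝔫.frac_ne_zero))
  have hJ : 𝔫.frac * ((R.𝔮 j).frac * 𝔫.frac⁻¹) = (R.𝔮 j).frac := by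
    rw [mul_comm _ 𝔫.frac⁻¹, mul_inv_cancel_left₀ 𝔫.frac_ne_zero]
  rw [hJ] at hc ⊢
  obtain ⟨𝔞, h𝔞, x, hx, hxa⟩ := (hasClass_mulRight_dsum_iff hA hq).1 hc
  rw [c_eq_mk0, eq_comm, ClassGroup.mk0_eq_mk0_iff_exists_fraction_ring K] at h𝔞
  obtain ⟨y, hy, hya⟩ := h𝔞
  change _ * (R.𝔭 i * R.𝔮 j * R.𝔮 j : NzIdeal K).frac = 𝔞.frac at hya
  -- Equality of classes says that `A𝔮_j` and `𝔭_i𝔮_j²` differ by a scalar; cancelling `𝔮_j`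
  -- identifies `A` up to that scalar.
  have hAeq : spanSingleton _ (x * y) * ((R.𝔭 i).frac * (R.𝔮 j).frac) = A := by
    apply mul_right_cancel₀ hq
    rw [← hxa, ← hya, frac_mul, ← spanSingleton_mul_spanSingleton]
    simp only [mul_assoc]
  obtain ⟨γ, hγ⟩ := mulRight_dsum_diagonal (mul_ne_zero hx hy)
  refine ⟨toHat γ * U, ?_⟩
  rw [IsAdmissible, pairMul_mul]
  congr 1
  rw [stdPoint, pairMul, hγ, hγ, hAeq]

theorem pairMul_stdPoint_eq_self_iff (𝔫 : NzIdeal K) (i : ι) (j : κ) {U : G K} :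
    pairMul (R.stdPoint 𝔫 i j) U = R.stdPoint 𝔫 i j ↔ U ∈ Γ₀hat (R.𝔭 i) 𝔫 := by
  have hA := R.frac_mul_ne_zero i j
  have hB := (R.𝔮 j).frac_ne_zero
  constructor
  · intro h
    obtain ⟨γ, rfl⟩ := exists_toHat_eq hA hB (congrArg Prod.fst h).le
    exact ⟨γ, (mem_Γ₀_iff_pairMul_eq hA hB rfl).2 h, rfl⟩
  · rintro ⟨γ, hγ, rfl⟩
    exact (mem_Γ₀_iff_pairMul_eq hA hB rfl).1 hγ

theorem pairMul_stdPoint_eq_iff (𝔫 : NzIdeal K) (i : ι) (j : κ) {U V : G K} :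
    pairMul (R.stdPoint 𝔫 i j) U = pairMul (R.stdPoint 𝔫 i j) V ↔
      V * U⁻¹ ∈ Γ₀hat (R.𝔭 i) 𝔫 := by
  rw [← R.pairMul_stdPoint_eq_self_iff 𝔫 i j, pairMul_mul]
  constructor
  · intro h
    rw [← h, ← pairMul_mul, mul_inv_cancel, pairMul_one]
  · intro h
    have h1 := congrArg (pairMul · U) h
    simpa [← pairMul_mul] using h1.symm

end ClassReps

theorem IsModularPoint.existsUnique_hasClass {ι κ : Type*} (R : ClassReps K ι κ) {𝔫 : NzIdeal K}
    {P : Submodule (𝓞 K) (Row K) × Submodule (𝓞 K) (Row K)} (hP : IsModularPoint 𝔫 P) :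
    ∃! ij : ι × κ, HasClass P.1 (R.c ij.1 ij.2) := by
  obtain ⟨A, B, U, hA, hB, hP1⟩ := hP.lattice_fst.exists_eq_mulRight_dsum
  rw [hP1]
  obtain ⟨c, hc⟩ := exists_hasClass hA hB U
  obtain ⟨ij, hij, huniq⟩ := R.existsUnique_c_eq c
  exact ⟨ij, by dsimp only at hij ⊢; rwa [hij],
    fun kl hkl => huniq kl (hasClass_unique hA hB hkl hc)⟩

end ModularPoints

end ModPt

theorem mainTheorem3 {K : Type*} [Field K] [NumberField K] {ι κ : Type*}
    (R : ModPt.ClassReps K ι κ) (𝔫 : ModPt.NzIdeal K) :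
    -- every modular point has a class `c_{ij}`, for exactly one pair `(i, j)`
    (∀ P ∈ ModPt.M₀ 𝔫, ∃! ij : ι × κ, ModPt.HasClass P.1 (R.c ij.1 ij.2)) ∧
    ∀ (i : ι) (j : κ),
      -- existence of an admissible basis matrix
      (∀ P ∈ ModPt.M₀Class 𝔫 (R.c i j), ∃ U : ModPt.G K, R.IsAdmissible 𝔫 i j P U) ∧
      -- uniqueness up to left multiplication
      (∀ P ∈ ModPt.M₀Class 𝔫 (R.c i j), ∀ U : ModPt.G K, R.IsAdmissible 𝔫 i j P U →
        {V : ModPt.G K | R.IsAdmissible 𝔫 i j P V} =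
          {V | ∃ γ ∈ ModPt.Γ₀hat (R.𝔭 i) 𝔫, V = γ * U}) ∧
      -- `𝓜₀^{(c_{ij})}(𝔫) = {P_{ij} U | U ∈ 𝒢}`
      ModPt.M₀Class 𝔫 (R.c i j) =
        Set.range (fun U : ModPt.G K => ModPt.pairMul (R.stdPoint 𝔫 i j) U) ∧
      -- `P_{ij} U ↔ U` is a bijection with the right cosets of `Γ₀^{𝔭ᵢ}(𝔫)` in `𝒢`
      ∃ e : Quotient (QuotientGroup.rightRel (ModPt.Γ₀hat (R.𝔭 i) 𝔫)) ≃
          ModPt.M₀Class 𝔫 (R.c i j),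
        ∀ U : ModPt.G K, (e (Quotient.mk _ U) : Submodule (𝓞 K) (ModPt.Row K) ×
          Submodule (𝓞 K) (ModPt.Row K)) = ModPt.pairMul (R.stdPoint 𝔫 i j) U := by
  refine ⟨fun P hP => ModPt.IsModularPoint.existsUnique_hasClass R hP, fun i j =>
    ⟨fun P hP => R.exists_isAdmissible 𝔫 i j hP, ?_, ?_, ?_⟩⟩
  · intro P _ U hU
    ext V
    rw [Set.mem_ofPred_eq, Set.mem_ofPred_eq, ModPt.ClassReps.IsAdmissible, hU,
      R.pairMul_stdPoint_eq_iff]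
    constructor
    · exact fun h => ⟨_, h, (inv_mul_cancel_right V U).symm⟩
    · rintro ⟨γ, hγ, rfl⟩
      rwa [mul_inv_cancel_right]
  · ext P
    constructor
    · intro hP
      obtain ⟨U, hU⟩ := R.exists_isAdmissible 𝔫 i j hP
      exact ⟨U, hU.symm⟩
    · rintro ⟨U, rfl⟩
      exact R.pairMul_stdPoint_mem 𝔫 i j U
  -- Well-definedness and injectivity are the two directions of `pairMul_stdPoint_eq_iff`;
  -- surjectivity is the existence of an admissible basis matrix.
  · refine ⟨Equiv.ofBijective (Quotient.lift
      (fun U => (⟨_, R.pairMul_stdPoint_mem 𝔫 i j U⟩ : ModPt.M₀Class 𝔫 (R.c i j)))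
      fun U V h => Subtype.ext ((R.pairMul_stdPoint_eq_iff 𝔫 i j).2
        (QuotientGroup.rightRel_apply.1 h))) ⟨?_, ?_⟩, fun U => rfl⟩
    · rintro ⟨U⟩ ⟨V⟩ h
      exact Quotient.sound (QuotientGroup.rightRel_apply.2
        ((R.pairMul_stdPoint_eq_iff 𝔫 i j).1 (congrArg Subtype.val h)))
    · rintro ⟨P, hP⟩
      obtain ⟨U, hU⟩ := R.exists_isAdmissible 𝔫 i j hP
      exact ⟨Quotient.mk _ U, Subtype.ext hU.symm⟩
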